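/- Let $\rho_A,\rho_B:\mathbb{R}^3\to[0,\infty)$ satisfy $\int_{\mathbb{R}^3}\rho_A=\int_{\mathbb{R}^3}\rho_B=1$ and $\sqrt{\rho_A},\sqrt{\rho_B}\in H^1(\mathbb{R}^3)$, where $H^1=\{u\in L^2 : \nabla u\in L^2\}$ with weak gradients. Let $\gamma$ be a nonnegative Radon measure on $\mathbb{R}^6=\mathbb{R}^3\times\mathbb{R}^3$ both of whose marginals are equal to $\rho_A$ (that is, to $\rho_A(x)\,dx$), and suppose that (i) $\gamma$ has a Lebesgue density, again denoted by $\gamma$, with $\sqrt{\gamma}\in H^1(\mathbb{R}^6)$; (ii) $\gamma\ge\beta\,\rho_A\otimes\rho_A$ for some constant $\beta>0$ (strong positivity). Put $f=\min\{\rho_A,\rho_B\}$, $f_A=(\rho_A-f)_+$, $f_B=(\rho_B-f)_+$, and define the measures $$\gamma_{A\to B}(x,y)=f(x)\,\delta_x(y)+\frac{f_A(x)f_B(y)}{\int_{\mathbb{R}^3} f_B},\qquad \gamma_{B\to A}(x,y)=f(x)\,\delta_x(y)+\frac{f_B(x)f_A(y)}{\int_{\mathbb{R}^3} f_A}$$ on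 $\mathbb{R}^6$, where the second terms are read as $0$ if $\rho_A=\rho_B$ almost everywhere. Let $P$ be the measure on $\mathbb{R}^6$ given by $$P(x,w)=\int_{\mathbb{R}^3}\int_{\mathbb{R}^3}\gamma_{B\to A}(x,y)\,\frac{\chi_{\rho_A>0}(y)}{\rho_A(y)}\,\gamma(y,z)\,\frac{\chi_{\rho_A>0}(z)}{\rho_A(z)}\,\gamma_{A\to B}(z,w)\,dy\,dz ,$$ that is, the image under $((x,y),(z,w))\mapsto(x,w)$ of the measure with density $\frac{\chi_{\rho_A>0}(y)}{\rho_A(y)}\gamma(y,z)\frac{\chi_{\rho_A>0}(z)}{\rho_A(z)}$ with respect to $\gamma_{B\to A}\otimes\gamma_{A\to B}$. Then both marginals of $P$ are equal to $\rho_B$, and $P$ has a Lebesgue density whose square root belongs to $H^1(\mathbb{R}^6)$, i.e. $\sqrt{P}\in H^1(\mathbb{R}^6)$. -/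

import Mathlib

open MeasureTheory

noncomputable section

namespace GluedPlan

/-- `ℝ³` with its Euclidean norm and Lebesgue measure. -/
abbrev R3 : Type := EuclideanSpace ℝ (Fin 3)

/-- `u ∈ H¹(F)` for real-valued `u`: `u ∈ L²` and `u` has a weak gradient `G ∈ L²`, where the
gradient at a point is regarded as a linear form. For `F = R3 × R3` this is `H¹(ℝ⁶)`: the volume on
the product is Lebesgue measure, and as all norms on `ℝ⁶` are equivalent, the choice of
norm does not affect membership. -/
def MemH1 {F : Type*} [NormedAddCommGroup F] [NormedSpace ℝ F] [MeasureSpace F]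
    (u : F → ℝ) : Prop :=
  MemLp u 2 volume ∧
    ∃ G : F → (F →L[ℝ] ℝ), MemLp G 2 volume ∧
      ∀ φ : F → ℝ, ContDiff ℝ ((⊤ : ℕ∞) : WithTop ℕ∞) φ → HasCompactSupport φ →
        ∀ v : F, ∫ x, u x * fderiv ℝ φ x v = -∫ x, G x v * φ x

/-- The measure `ρ(x) dx` with (nonnegative) Lebesgue density `ρ`. -/
def densityMeasure {F : Type*} [MeasureSpace F] (ρ : F → ℝ) : Measure F :=
  volume.withDensity fun x => ENNReal.ofReal (ρ x)

/-- `√μ ∈ H¹` for a nonnegative measure `μ`: it has a Lebesgue density, the square root of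
which belongs to `H¹`. -/
def SqrtMemH1 {F : Type*} [NormedAddCommGroup F] [NormedSpace ℝ F] [MeasureSpace F]
    (μ : Measure F) : Prop :=
  ∃ g : F → ℝ, (∀ x, 0 ≤ g x) ∧ μ = densityMeasure g ∧ MemH1 fun x => √(g x)

/-- `γ` has first marginal `μ` and second marginal `ν`. -/
def HasMarginals (γ : Measure (R3 × R3)) (μ ν : Measure R3) : Prop :=
  γ.map Prod.fst = μ ∧ γ.map Prod.snd = ν

/-- `γ ≥ β μ ⊗ ν` for some constant `β > 0`, where `μ`, `ν` are the marginals of `γ`. -/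
def StronglyPositive (γ : Measure (R3 × R3)) : Prop :=
  ∃ β : ℝ, 0 < β ∧
    ENNReal.ofReal β • (γ.map Prod.fst).prod (γ.map Prod.snd) ≤ γ

/-- The excess `(ρ - min{ρ, σ})₊` of `ρ` over `σ`. -/
def excess (ρ σ : R3 → ℝ) (x : R3) : ℝ := max (ρ x - min (ρ x) (σ x)) 0

/-- The plan `f(x) δ_x(y) + f_ρ(x) f_σ(y) / ∫ f_σ` from `ρ` to `σ`, where `f = min{ρ, σ}`,
`f_ρ = (ρ - f)₊` and `f_σ = (σ - f)₊`. If `∫ f_σ = 0`, the second term is `0`. -/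
def basicPlan (ρ σ : R3 → ℝ) : Measure (R3 × R3) :=
  (densityMeasure fun x => min (ρ x) (σ x)).map (fun x => (x, x)) +
    densityMeasure fun p : R3 × R3 => excess ρ σ p.1 * excess σ ρ p.2 / ∫ y, excess σ ρ y

/-- `χ_{ρ > 0}(x) / ρ(x)`. -/
def invOnPos (ρ : R3 → ℝ) (x : R3) : ℝ := if 0 < ρ x then 1 / ρ x else 0

/-- The combined plan
`P(x,w) = ∬ γ_{B→A}(x,y) (χ_{ρA>0}(y)/ρA(y)) γ(y,z) (χ_{ρA>0}(z)/ρA(z)) γ_{A→B}(z,w) dy dz`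
as a measure in `(x,w)`, for a plan `γ` with a Lebesgue density. As `γ_{B→A}` and `γ_{A→B}` have
singular parts, the integrand is read as the measure on the points `((x,y),(z,w))` that has density
`(χ_{ρA>0}(y)/ρA(y)) γ(y,z) (χ_{ρA>0}(z)/ρA(z))` with respect to `γ_{B→A} ⊗ γ_{A→B}`;
integrating out `y` and `z` is the projection to `(x,w)`. -/
def combinedPlan (ρA ρB : R3 → ℝ) (γ : Measure (R3 × R3)) : Measure (R3 × R3) :=
  (((basicPlan ρB ρA).prod (basicPlan ρA ρB)).withDensity
      fun q : (R3 × R3) × (R3 × R3) =>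
        ENNReal.ofReal (invOnPos ρA q.1.2) * γ.rnDeriv volume (q.1.2, q.2.1) *
          ENNReal.ofReal (invOnPos ρA q.2.1)).map
    fun q => (q.1.1, q.2.2)

end GluedPlan

end

open GluedPlan

open MeasureTheory Filter Topology
open scoped ENNReal NNReal ContDiff Convolution

namespace GluedPlan

/-! ### Pairings and norms in L². -/

section L2

variable {α : Type*} [MeasureSpace α]

/-! Membership in H¹ is equivalent, for `u ∈ L²`, to the bound `‖u(· + v) - u‖₂² ≤ C ‖v‖²` for all
`v` (`MemH1.lipschitzTranslates`, `memH1_of_lipschitzTranslates`). The whole argument runs on such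
difference bounds, so no weak derivative of a minimum, a quotient or a square root is ever computed.
On a product it suffices to translate one variable at a time.

Write `ρ, σ` for the two densities and `G` for the density of `γ`. Integrating out `z` against the
plan from `ρ` to `σ` turns `G` into `Γ(y,w) = h(w) G(y,w) + l(w) ∫ k(z) G(y,z) dz`, with `h =
min(ρ,σ)/ρ`, `k = (ρ-σ)₊/ρ` and `l` the normalised excess `(σ-ρ)₊`. The same operation in the first
variable gives the density of `P` (`combinedPlan_eq_withDensity`), and both marginals follow by
Fubini.

For translations in `x` the two operations behave differently. The one in the second variable is
harmless: `Γ(y,w)` integrates `G(y,·)` against a measure depending only on `w`, so the reverse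
Minkowski inequality bounds the increments of `√Γ` by those of `√G`, and the total mass does not
grow (`LipschitzTranslatesFst.transferSnd`).

The one in the first variable gives `h(x) Γ(x,w) + l(x) M(w)`, whose coefficients depend on `x`.
Here `√l` need not be in H¹, since `(σ-ρ)₊` may vanish linearly. Strong positivity repairs this: it
yields `Γ(x,w) ≥ β ρ(x) M(w)`, hence the sum dominates a multiple of `σ(x) M(w)`. The increment of
its square root is then controlled by those of `√Γ`, `√ρ` and `√σ`, the latter two with weights
`√(Γ/ρ)` and `√M` (`abs_sqrt_glued_sub_le`). These weights are square integrable in `w` uniformly in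
`x`, because the first marginal of `Γ` is at most `ρ` (`lipschitzTranslatesFst_glued`).

Translations in `w` reduce to those in `x` by symmetry: exchanging the variables of `G` exchanges
those of `P`. -/

theorem inner_toLp_eq_integral {w φ : α → ℝ} (hw : MemLp w 2 volume) (hφ : MemLp φ 2 volume) :
    inner ℝ (hw.toLp w) (hφ.toLp φ) = ∫ x, w x * φ x := by
  rw [L2.inner_def]
  refine integral_congr_ae ?_
  filter_upwards [hw.coeFn_toLp, hφ.coeFn_toLp] with x h1 h2
  rw [h1, h2]
  simp [mul_comm]

theorem abs_integral_mul_le_eLpNorm {w φ : α → ℝ} (hw : MemLp w 2 volume)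
    (hφ : MemLp φ 2 volume) :
    |∫ x, w x * φ x| ≤ (eLpNorm w 2 volume).toReal * (eLpNorm φ 2 volume).toReal := by
  rw [← inner_toLp_eq_integral hw hφ, ← Lp.norm_toLp w hw, ← Lp.norm_toLp φ hφ]
  exact abs_real_inner_le_norm _ _

theorem lintegral_enorm_sq {Z : Type*} [MeasurableSpace Z] {μ : Measure Z} (w : Z → ℝ) :
    ∫⁻ x, ‖w x‖ₑ ^ 2 ∂μ = eLpNorm w 2 μ ^ 2 := by
  rw [eLpNorm_eq_lintegral_rpow_enorm_toReal (by norm_num) (by norm_num)]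
  rw [← ENNReal.rpow_natCast, ← ENNReal.rpow_mul]
  simp

theorem enorm_sq_eq_ofReal (x : ℝ) : ‖x‖ₑ ^ 2 = ENNReal.ofReal (x ^ 2) := by
  rw [Real.enorm_eq_ofReal_abs, ← ENNReal.ofReal_pow (abs_nonneg x), sq_abs]

end L2

set_option linter.unusedSectionVars false

/-! ### H¹ as the space of L² functions with Lipschitz translates. -/

section Pairing

variable {F : Type*} [NormedAddCommGroup F] [NormedSpace ℝ F] [FiniteDimensional ℝ F]
  [MeasureSpace F] [BorelSpace F] [(volume : Measure F).IsAddHaarMeasure]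

theorem memLp_of_smooth {φ : F → ℝ} (hφ : ContDiff ℝ ∞ φ) (hc : HasCompactSupport φ) :
    MemLp φ 2 (volume : Measure F) :=
  hφ.continuous.memLp_of_hasCompactSupport hc

/-- Differentiation of the pairing of `u` with the translates of a test function. -/
theorem hasFDerivAt_pairing {u φ : F → ℝ} (hu : MemLp u 2 volume)
    (hφ : ContDiff ℝ ∞ φ) (hc : HasCompactSupport φ) (y : F) :
    ∃ L : F →L[ℝ] ℝ, HasFDerivAt (fun y => ∫ x, u x * φ (x - y)) L y ∧
      ∀ v, L v = -∫ x, u x * fderiv ℝ φ (x - y) v := by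
  have hloc : LocallyIntegrable u volume := hu.locallyIntegrable (by norm_num)
  -- Reflection turns the pairing with translates into a convolution, which is differentiable in its
  -- smooth factor.
  set ψ : F → ℝ := fun z => φ (-z) with hψ
  have hψs : ContDiff ℝ ∞ ψ := hφ.comp contDiff_neg
  have hψc : HasCompactSupport ψ := hc.comp_homeomorph (Homeomorph.neg F)
  have hd := hψc.hasFDerivAt_convolution_right (ContinuousLinearMap.mul ℝ ℝ) hloc
    (hψs.of_le (by exact_mod_cast le_top)) y
  have hdψ : ∀ z, fderiv ℝ ψ z = -fderiv ℝ φ (-z) := by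
    intro z
    have h1 : HasFDerivAt φ (fderiv ℝ φ (-z)) (-z) :=
      (hφ.differentiable (by simp)).differentiableAt.hasFDerivAt
    have h2 := h1.comp z (hasFDerivAt_id z).neg
    have := h2.fderiv
    rw [show fderiv ℝ ψ z = _ from this]; ext; simp
  refine ⟨(u ⋆[(ContinuousLinearMap.mul ℝ ℝ).precompR F, volume] fderiv ℝ ψ) y, ?_, ?_⟩
  · have he : (fun y => ∫ x, u x * φ (x - y)) =
        u ⋆[ContinuousLinearMap.mul ℝ ℝ, volume] ψ := by
      ext y; simp [convolution, hψ]
    rw [he]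
    exact hd
  · intro v
    have hint : ConvolutionExistsAt u (fderiv ℝ ψ) y
        ((ContinuousLinearMap.mul ℝ ℝ).precompR F) volume :=
      (hψc.fderiv ℝ).convolutionExists_right _ hloc
        (hψs.continuous_fderiv (by simp)) y
    rw [convolution_def, ContinuousLinearMap.integral_apply hint, ← integral_neg]
    refine integral_congr_ae (Eventually.of_forall fun x => ?_)
    simp [hdψ]

theorem memLp_translate {u : F → ℝ} (hu : MemLp u 2 volume) (v : F) :
    MemLp (fun x => u (x + v)) 2 volume :=
  hu.comp_measurePreserving (measurePreserving_add_right volume v)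

theorem integral_translate_sub_mul {u φ : F → ℝ} (hu : MemLp u 2 volume)
    (hφ : ContDiff ℝ ∞ φ) (hc : HasCompactSupport φ) (v : F) :
    ∫ x, (u (x + v) - u x) * φ x = (∫ x, u x * φ (x - v)) - ∫ x, u x * φ (x - 0) := by
  have hφ2 := memLp_of_smooth hφ hc
  have h1 : ∫ x, u x * φ (x - v) = ∫ x, u (x + v) * φ x := by
    rw [← integral_add_right_eq_self _ v]; simp
  rw [h1, ← integral_sub]
  · simp [sub_mul]
  · exact (memLp_translate hu v).integrable_mul hφ2
  · simpa only [sub_zero] using! hu.integrable_mul hφ2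

/-- `v ↦ u (· + v)` is Lipschitz from `F` to `L²`. -/
def LipschitzTranslates (u : F → ℝ) : Prop :=
  ∃ C : ℝ≥0, ∀ v : F, ∫⁻ x, ‖u (x + v) - u x‖ₑ ^ 2 ≤ C * ‖v‖ₑ ^ 2

/-- By density of the test functions in L² the bound extends to every L² function; testing `w`
against itself gives the claim. -/
theorem eLpNorm_le_of_pairing {w : F → ℝ} (hw : MemLp w 2 volume) {K : ℝ} (hK : 0 ≤ K)
    (h : ∀ φ : F → ℝ, ContDiff ℝ ∞ φ → HasCompactSupport φ →
      |∫ x, w x * φ x| ≤ K * (eLpNorm φ 2 volume).toReal) :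
    (eLpNorm w 2 volume).toReal ≤ K := by
  have key : ∀ f : Lp ℝ 2 (volume : Measure F), inner ℝ (hw.toLp w) f ≤ K * ‖f‖ := by
    have hd := Lp.dense_hasCompactSupport_contDiff (E := F) (F := ℝ) (μ := volume)
      (p := 2) (by norm_num)
    intro f
    refine hd.induction (P := fun f => inner ℝ (hw.toLp w) f ≤ K * ‖f‖) ?_ ?_ f
    · rintro f ⟨g, hfg, hgc, hgs⟩
      have hg2 := memLp_of_smooth hgs hgc
      have : f = hg2.toLp g := by
        apply Lp.ext
        exact hfg.trans hg2.coeFn_toLp.symm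
      rw [this, inner_toLp_eq_integral, Lp.norm_toLp]
      exact (le_abs_self _).trans (h g hgs hgc)
    · exact isClosed_le (by fun_prop) (by fun_prop)
  have h1 := key (hw.toLp w)
  rw [real_inner_self_eq_norm_mul_norm] at h1
  rw [← Lp.norm_toLp w hw]
  by_contra hlt
  push Not at hlt
  nlinarith [norm_nonneg (hw.toLp w)]

/-- The pairing of `u` with the translate of `φ` by `y` has, as a function of `y`, derivative at
most `‖G‖₂ ‖φ‖₂`. The mean value inequality bounds the pairing of `u(· + v) - u` with `φ`, and
duality removes `φ`. -/
theorem MemH1.lipschitzTranslates {u : F → ℝ} (h : MemH1 u) : LipschitzTranslates u := by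
  obtain ⟨hu, G, hG, hw⟩ := h
  set K := (eLpNorm G 2 volume).toReal with hK
  have hK0 : 0 ≤ K := ENNReal.toReal_nonneg
  have main : ∀ v, (eLpNorm (fun x => u (x + v) - u x) 2 volume).toReal ≤ K * ‖v‖ := by
    intro v
    have hdif : MemLp (fun x => u (x + v) - u x) 2 volume := (memLp_translate hu v).sub hu
    refine eLpNorm_le_of_pairing hdif (by positivity) fun φ hφ hc => ?_
    have hφ2 := memLp_of_smooth hφ hc
    rw [integral_translate_sub_mul hu hφ hc]
    choose L hL hLv using fun y => hasFDerivAt_pairing hu hφ hc y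
    have hb : ∀ y, ‖L y‖ ≤ K * (eLpNorm φ 2 volume).toReal := by
      intro y
      refine ContinuousLinearMap.opNorm_le_bound _ (by positivity) fun w => ?_
      have hts : ContDiff ℝ ∞ (fun x => φ (x - y)) := hφ.comp (contDiff_id.sub contDiff_const)
      have htc : HasCompactSupport (fun x => φ (x - y)) :=
        hc.comp_homeomorph (Homeomorph.subRight y)
      have hfd : ∀ x, fderiv ℝ (fun x => φ (x - y)) x = fderiv ℝ φ (x - y) := by
        intro x; rw [fderiv_comp_sub]
      have h1 := hw _ hts htc w
      simp only [hfd] at h1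
      rw [hLv, h1, neg_neg, Real.norm_eq_abs]
      have hGw : MemLp (fun x => G x w) 2 volume :=
        (ContinuousLinearMap.apply ℝ ℝ w).comp_memLp' hG
      refine (abs_integral_mul_le_eLpNorm hGw (memLp_of_smooth hts htc)).trans ?_
      have e1 : eLpNorm (fun x => φ (x - y)) 2 volume = eLpNorm φ 2 volume :=
        eLpNorm_comp_measurePreserving hφ2.1 (measurePreserving_sub_right volume y)
      have e2 : (eLpNorm (fun x => G x w) 2 volume).toReal ≤ ‖w‖ * K := by
        have : eLpNorm (fun x => G x w) 2 volume ≤ ‖w‖ₑ * eLpNorm G 2 volume := by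
          refine (eLpNorm_le_nnreal_smul_eLpNorm_of_ae_le_mul (c := ‖w‖₊) (g := G)
            (Eventually.of_forall fun x => ?_) 2).trans_eq ?_
          · rw [mul_comm]; exact (G x).le_opNNNorm w
          · rfl
        have := ENNReal.toReal_mono (ENNReal.mul_ne_top (by simp) hG.2.ne) this
        simpa using this
      rw [e1]
      calc _ ≤ (‖w‖ * K) * (eLpNorm φ 2 volume).toReal := by gcongr
        _ = _ := by ring
    have := Convex.norm_image_sub_le_of_norm_hasFDerivWithin_le (𝕜 := ℝ)
      (s := Set.univ) (x := 0) (y := v)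
      (fun y _ => (hL y).hasFDerivWithinAt) (fun y _ => hb y) convex_univ trivial trivial
    rw [Real.norm_eq_abs] at this
    refine this.trans_eq ?_
    simp; ring
  refine ⟨(K ^ 2).toNNReal, fun v => ?_⟩
  have hdif : MemLp (fun x => u (x + v) - u x) 2 volume := (memLp_translate hu v).sub hu
  rw [lintegral_enorm_sq, ← ENNReal.ofReal_toReal hdif.2.ne, ← ofReal_norm v,
    ← ENNReal.ofReal_pow ENNReal.toReal_nonneg, ← ENNReal.ofReal_pow (norm_nonneg _),
    ← ENNReal.ofReal.eq_1, ← ENNReal.ofReal_mul (by positivity)]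
  refine ENNReal.ofReal_le_ofReal ?_
  calc _ ≤ (K * ‖v‖) ^ 2 := by gcongr; exact main v
    _ = _ := by ring

/-- The difference quotients along `v` are bounded in L², so Banach–Alaoglu and the Riesz
representation provide a weak limit `g`; against a test function they converge to the derivative of
the pairing. -/
theorem exists_weak_directional_derivative {u : F → ℝ} (hu : MemLp u 2 volume)
    (h : LipschitzTranslates u) (v : F) :
    ∃ g : F → ℝ, MemLp g 2 volume ∧ ∀ φ : F → ℝ, ContDiff ℝ ∞ φ → HasCompactSupport φ →
      ∫ x, u x * fderiv ℝ φ x v = -∫ x, g x * φ x := by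
  obtain ⟨C, hC⟩ := h
  have hdif : ∀ v, MemLp (fun x => u (x + v) - u x) 2 volume := fun v =>
    (memLp_translate hu v).sub hu
  set t : ℕ → ℝ := fun n => 1 / ((n : ℝ) + 1) with ht
  have ht0 : ∀ n, 0 < t n := fun n => by positivity
  set d : ℕ → Lp ℝ 2 (volume : Measure F) := fun n =>
    (t n)⁻¹ • (hdif (t n • v)).toLp _ with hd
  have hbound : ∀ n, ‖d n‖ ≤ √C * ‖v‖ := by
    intro n
    have h1 : ‖(hdif (t n • v)).toLp _‖ ≤ √C * (t n * ‖v‖) := by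
      have h2 := hC (t n • v)
      rw [lintegral_enorm_sq] at h2
      have h3 := ENNReal.toReal_mono
        (ENNReal.mul_ne_top ENNReal.coe_ne_top (by simp)) h2
      rw [Lp.norm_toLp]
      simp only [ENNReal.toReal_pow, ENNReal.toReal_mul, ENNReal.coe_toReal, toReal_enorm,
        norm_smul, Real.norm_eq_abs, abs_of_pos (ht0 n)] at h3
      refine abs_le_of_sq_le_sq' ?_ (by have := (ht0 n).le; positivity) |>.2
      rw [mul_pow, Real.sq_sqrt C.coe_nonneg]
      exact h3
    rw [hd, norm_smul, norm_inv, Real.norm_eq_abs, abs_of_pos (ht0 n), inv_mul_le_iff₀ (ht0 n)]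
    linarith
  set ℓ : ℕ → WeakDual ℝ (Lp ℝ 2 (volume : Measure F)) := fun n =>
    StrongDual.toWeakDual (InnerProductSpace.toDual ℝ _ (d n)) with hℓ
  have hcomp := WeakDual.isCompact_closedBall (𝕜 := ℝ)
    (0 : StrongDual ℝ (Lp ℝ 2 (volume : Measure F))) (√C * ‖v‖)
  -- A limit along an ultrafilter replaces the extraction of a weakly convergent subsequence.
  obtain ⟨m, -, hm⟩ := hcomp.ultrafilter_le_nhds ((hyperfilter ℕ).map ℓ) (by
    rw [Ultrafilter.coe_map, le_principal_iff, mem_map]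
    refine univ_mem' fun n => ?_
    simp only [Set.mem_preimage, mem_closedBall_zero_iff, hℓ]
    exact (LinearIsometryEquiv.norm_map (InnerProductSpace.toDual ℝ _) (d n)).trans_le (hbound n))
  have hm' : Tendsto ℓ (hyperfilter ℕ) (𝓝 m) := hm
  obtain ⟨g, hg⟩ := (InnerProductSpace.toDual ℝ (Lp ℝ 2 (volume : Measure F))).surjective
    (WeakDual.toStrongDual m)
  refine ⟨g, Lp.memLp g, fun φ hφ hc => ?_⟩
  have hφ2 := memLp_of_smooth hφ hc
  have hlim : Tendsto (fun n => ℓ n (hφ2.toLp φ)) (hyperfilter ℕ) (𝓝 (m (hφ2.toLp φ))) :=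
    ((WeakDual.eval_continuous (hφ2.toLp φ)).tendsto m).comp hm'
  have hval : m (hφ2.toLp φ) = ∫ x, g x * φ x := by
    have h1 : m (hφ2.toLp φ) = inner ℝ g (hφ2.toLp φ) := by
      rw [← InnerProductSpace.toDual_apply_apply, hg]; rfl
    rw [h1]
    conv_lhs => rw [← Lp.toLp_coeFn g (Lp.memLp g)]
    exact inner_toLp_eq_integral (Lp.memLp g) hφ2
  obtain ⟨L, hL, hLv⟩ := hasFDerivAt_pairing hu hφ hc 0
  have hquot : ∀ n, ℓ n (hφ2.toLp φ) =
      (t n)⁻¹ • ((∫ x, u x * φ (x - (0 + t n • v))) - ∫ x, u x * φ (x - 0)) := by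
    intro n
    have h1 : ℓ n (hφ2.toLp φ) = inner ℝ (d n) (hφ2.toLp φ) := rfl
    rw [h1, hd, real_inner_smul_left, inner_toLp_eq_integral, integral_translate_sub_mul hu hφ hc,
      zero_add, smul_eq_mul]
  have htlim : Tendsto t atTop (𝓝[≠] 0) := by
    rw [tendsto_nhdsWithin_iff]
    exact ⟨tendsto_one_div_add_atTop_nhds_zero_nat, Eventually.of_forall fun n => (ht0 n).ne'⟩
  have hder : Tendsto (fun n => ℓ n (hφ2.toLp φ)) atTop (𝓝 (L v)) := by
    simp_rw [hquot]
    have := (hL.hasLineDerivAt v).tendsto_slope_zero.comp htlim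
    simpa [Function.comp_def] using this
  -- The hyperfilter is finer than `atTop`, so the weak limit and the classical derivative agree.
  have := tendsto_nhds_unique hlim (hder.mono_left Nat.hyperfilter_le_atTop)
  rw [hval, hLv] at this
  simp only [sub_zero] at this
  linarith

/-- The directional derivatives are chosen separately and need not be linear in the direction. The
gradient is therefore built from those along a basis, and a general direction is expanded in it. -/
theorem memH1_of_lipschitzTranslates {u : F → ℝ} (hu : MemLp u 2 volume)
    (h : LipschitzTranslates u) : MemH1 u := by
  refine ⟨hu, ?_⟩
  choose g hg hgw using exists_weak_directional_derivative hu h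
  obtain ⟨n, b, c, hbc⟩ : ∃ (n : ℕ) (b : Fin n → F) (c : Fin n → (F →L[ℝ] ℝ)),
      ∀ v, ∑ i, c i v • b i = v :=
    ⟨_, Module.finBasis ℝ F,
      fun i => LinearMap.toContinuousLinearMap ((Module.finBasis ℝ F).coord i),
      (Module.finBasis ℝ F).sum_repr⟩
  refine ⟨fun x => ∑ i, g (b i) x • c i, ?_, fun φ hφ hc v => ?_⟩
  · have hi : ∀ i, MemLp (fun x => g (b i) x • c i) 2 volume := fun i =>
      (ContinuousLinearMap.smulRight (1 : ℝ →L[ℝ] ℝ) (c i)).comp_memLp' (hg (b i))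
    exact memLp_finsetSum (f := fun i x => g (b i) x • c i) Finset.univ fun i _ => hi i
  have hv := hbc v
  have hφ2 := memLp_of_smooth hφ hc
  have hd2 : ∀ w, MemLp (fun x => fderiv ℝ φ x w) 2 volume := fun w =>
    ((hφ.continuous_fderiv (by simp)).clm_apply continuous_const).memLp_of_hasCompactSupport
      (hc.fderiv_apply ℝ w)
  have h1 : ∀ x, u x * fderiv ℝ φ x v = ∑ i, c i v * (u x * fderiv ℝ φ x (b i)) := by
    intro x
    conv_lhs => rw [← hv]
    simp only [map_sum, map_smul, smul_eq_mul, Finset.mul_sum]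
    exact Finset.sum_congr rfl fun i _ => by ring
  have h2 : ∀ x, (∑ i, g (b i) x • c i) v * φ x = ∑ i, c i v * (g (b i) x * φ x) := by
    intro x
    simp only [sum_apply, smul_apply, smul_eq_mul,
      Finset.sum_mul]
    exact Finset.sum_congr rfl fun i _ => by ring
  have hi1 : ∀ i, Integrable (fun x => c i v * (u x * fderiv ℝ φ x (b i))) volume := fun i =>
    (hu.integrable_mul (hd2 (b i))).const_mul (c i v)
  have hi2 : ∀ i, Integrable (fun x => c i v * (g (b i) x * φ x)) volume := fun i =>
    ((hg (b i)).integrable_mul hφ2).const_mul (c i v)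
  simp_rw [h1, h2]
  rw [integral_finsetSum _ fun i _ => hi1 i, integral_finsetSum _ fun i _ => hi2 i,
    ← Finset.sum_neg_distrib]
  refine Finset.sum_congr rfl fun i _ => ?_
  rw [integral_const_mul, integral_const_mul, hgw _ φ hφ hc]
  ring

theorem LipschitzTranslates.congr_ae {u u' : F → ℝ} (h : LipschitzTranslates u)
    (huu : u =ᵐ[volume] u') : LipschitzTranslates u' := by
  obtain ⟨C, hC⟩ := h
  refine ⟨C, fun v => (lintegral_congr_ae ?_).trans_le (hC v)⟩
  filter_upwards [huu, (measurePreserving_add_right volume v).quasiMeasurePreserving.ae huu]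
    with x h1 h2
  rw [h1, h2]

end Pairing

/-! ### Translations of one variable at a time. -/

section Product

variable {E : Type*} [NormedAddCommGroup E] [NormedSpace ℝ E] [FiniteDimensional ℝ E]
  [MeasureSpace E] [BorelSpace E] [(volume : Measure E).IsAddHaarMeasure]

instance isAddHaarMeasure_volume_prod : (volume : Measure (E × E)).IsAddHaarMeasure :=
  inferInstanceAs ((volume : Measure E).prod (volume : Measure E)).IsAddHaarMeasure

/-- Translation in the first variable is Lipschitz into `L²`. -/
def LipschitzTranslatesFst (u : E × E → ℝ) : Prop :=
  ∃ C : ℝ≥0, ∀ v : E, ∫⁻ p : E × E, ‖u (p.1 + v, p.2) - u p‖ₑ ^ 2 ≤ C * ‖v‖ₑ ^ 2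

theorem LipschitzTranslates.fst {u : E × E → ℝ} (h : LipschitzTranslates u) :
    LipschitzTranslatesFst u := by
  obtain ⟨C, hC⟩ := h
  refine ⟨C, fun v => ?_⟩
  have hv : ‖((v, 0) : E × E)‖ₑ = ‖v‖ₑ := by
    rw [← ofReal_norm, ← ofReal_norm, Prod.norm_mk]; simp
  simpa [hv, Prod.add_def] using hC (v, 0)

theorem lintegral_comp_swap (f : E × E → ℝ≥0∞) :
    ∫⁻ p : E × E, f p.swap = ∫⁻ p, f p :=
  (Measure.measurePreserving_swap (μ := (volume : Measure E)) (ν := (volume : Measure E))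
    ).lintegral_comp_emb MeasurableEquiv.prodComm.measurableEmbedding f

theorem LipschitzTranslates.swap {u : E × E → ℝ} (h : LipschitzTranslates u) :
    LipschitzTranslates (fun p : E × E => u p.swap) := by
  obtain ⟨C, hC⟩ := h
  refine ⟨C, fun v : E × E => ?_⟩
  have := hC v.swap
  rw [← lintegral_comp_swap] at this
  have hv : ‖v.swap‖ₑ = ‖v‖ₑ := by
    rw [← ofReal_norm, ← ofReal_norm, Prod.norm_def, Prod.norm_def]; simp [max_comm]
  simpa [hv] using this

/-- A translation is a translation in the second variable followed by one in the first; the squares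
are added with a factor 2. -/
theorem lipschitzTranslates_of_fst_of_swap {u : E × E → ℝ} (hu : Measurable u)
    (h1 : LipschitzTranslatesFst u) (h2 : LipschitzTranslatesFst fun p : E × E => u p.swap) :
    LipschitzTranslates u := by
  obtain ⟨C, hC⟩ := h1
  obtain ⟨D, hD⟩ := h2
  refine ⟨2 * (C + D), fun v : E × E => ?_⟩
  have hn1 : ‖v.1‖ₑ ≤ ‖v‖ₑ := by
    rw [← ofReal_norm, ← ofReal_norm]; exact ENNReal.ofReal_le_ofReal (norm_fst_le v)
  have hn2 : ‖v.2‖ₑ ≤ ‖v‖ₑ := by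
    rw [← ofReal_norm, ← ofReal_norm]; exact ENNReal.ofReal_le_ofReal (norm_snd_le v)
  have e1 : ∫⁻ p : E × E, ‖u (p.1 + v.1, p.2 + v.2) - u (p.1, p.2 + v.2)‖ₑ ^ 2
      ≤ C * ‖v‖ₑ ^ 2 := by
    have ht := lintegral_add_right_eq_self (μ := (volume : Measure (E × E)))
      (fun p : E × E => ‖u (p.1 + v.1, p.2) - u p‖ₑ ^ 2) ((0 : E), v.2)
    simp only [add_zero, Prod.add_def] at ht
    rw [ht]
    refine (hC v.1).trans ?_
    gcongr
  have e2 : ∫⁻ p : E × E, ‖u (p.1, p.2 + v.2) - u p‖ₑ ^ 2 ≤ D * ‖v‖ₑ ^ 2 := by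
    have hs := lintegral_comp_swap fun p : E × E => ‖u (p.1, p.2 + v.2) - u p‖ₑ ^ 2
    rw [← hs]
    refine (hD v.2).trans ?_
    gcongr
  have hpt : ∀ p : E × E, ‖u (p + v) - u p‖ₑ ^ 2 ≤
      2 * (‖u (p.1 + v.1, p.2 + v.2) - u (p.1, p.2 + v.2)‖ₑ ^ 2
        + ‖u (p.1, p.2 + v.2) - u p‖ₑ ^ 2) := by
    intro p
    have h3 : u (p + v) - u p = (u (p.1 + v.1, p.2 + v.2) - u (p.1, p.2 + v.2))
        + (u (p.1, p.2 + v.2) - u p) := by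
      rw [Prod.add_def]; ring
    rw [h3]
    simp only [enorm_sq_eq_ofReal]
    rw [← ENNReal.ofReal_add (by positivity) (by positivity),
      show (2 : ℝ≥0∞) = ENNReal.ofReal 2 by simp, ← ENNReal.ofReal_mul (by norm_num)]
    exact ENNReal.ofReal_le_ofReal add_sq_le
  calc _ ≤ _ := lintegral_mono hpt
    _ = 2 * (_ + _) := by
      rw [lintegral_const_mul' _ _ (by norm_num), lintegral_add_left (by fun_prop)]
    _ ≤ 2 * (C * ‖v‖ₑ ^ 2 + D * ‖v‖ₑ ^ 2) := by gcongr
    _ = _ := by push_cast; ring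

end Product

/-! ### Pointwise inequalities for the square root of the glued density. -/

section Pointwise

/-- The ratio `min a b / a` varies, relative to `a`, no faster than `a` and `b`. -/
theorem abs_min_div_sub_le {a b a' b' : ℝ} (ha : 0 ≤ a) (hb : 0 ≤ b) (ha' : 0 ≤ a')
    (hb' : 0 ≤ b') :
    |min a' b' / a' - min a b / a| * a ≤ 2 * (|a' - a| + |b' - b|) := by
  have hm : |min a' b' - min a b| ≤ |a' - a| + |b' - b| :=
    (abs_min_sub_min_le_max a' b' a b).trans
      (max_le_add_of_nonneg (abs_nonneg _) (abs_nonneg _))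
  have hm0 : 0 ≤ min a b := le_min ha hb
  have hm0' : 0 ≤ min a' b' := le_min ha' hb'
  set m := min a b
  set m' := min a' b' with hm'
  have hle : m' ≤ a' := min_le_left _ _
  have h1 := abs_nonneg (a' - a)
  have h2 := abs_nonneg (b' - b)
  rcases ha.eq_or_lt with h0 | h0
  · rw [← h0]; simp; positivity
  have hθ0 : 0 ≤ m' / a' := by positivity
  have hθ1 : m' / a' ≤ 1 := div_le_one_of_le₀ hle ha'
  have hθa : m' / a' * a' = m' := by
    rcases ha'.eq_or_lt with h | h
    · have : m' = 0 := le_antisymm (hle.trans h.symm.le) hm0'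
      simp [this]
    · field_simp
  -- The coefficient of `a' - a` is the new ratio, which is at most 1, so no quotient by a small
  -- number survives.
  have e : (m' / a' - m / a) * a = (m' - m) - m' / a' * (a' - a) := by
    have : m / a * a = m := by field_simp
    linear_combination (-1 : ℝ) * this + hθa
  rw [← abs_of_pos h0, ← abs_mul, abs_of_pos h0, e]
  calc _ ≤ |m' - m| + |m' / a' * (a' - a)| := abs_sub _ _
    _ ≤ (|a' - a| + |b' - b|) + 1 * |a' - a| := by
      rw [abs_mul, abs_of_nonneg hθ0]; gcongr
    _ ≤ _ := by linarith

theorem abs_min_div_mul_sub_le {a b a' b' g g' : ℝ} (ha : 0 ≤ a) (hb : 0 ≤ b) (ha' : 0 ≤ a')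
    (hb' : 0 ≤ b') (hg : 0 ≤ g) (hg0 : a = 0 → g = 0) :
    |min a' b' / a' * g' - min a b / a * g| ≤
      |g' - g| + 2 * (|a' - a| + |b' - b|) * (g / a) := by
  have h := abs_min_div_sub_le ha hb ha' hb'
  have hθ0 : 0 ≤ min a' b' / a' := div_nonneg (le_min ha' hb') ha'
  have hθ1 : min a' b' / a' ≤ 1 := div_le_one_of_le₀ (min_le_left _ _) ha'
  have hga : g = a * (g / a) := by
    rcases ha.eq_or_lt with h0 | h0
    · simp [hg0 h0.symm]
    · field_simp
  have e : min a' b' / a' * g' - min a b / a * g =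
      min a' b' / a' * (g' - g) + (min a' b' / a' - min a b / a) * g := by ring
  rw [e]
  refine (abs_add_le _ _).trans (add_le_add ?_ ?_)
  · rw [abs_mul, abs_of_nonneg hθ0]
    exact mul_le_of_le_one_left (abs_nonneg _) hθ1
  · rw [abs_mul, abs_of_nonneg hg]
    conv_lhs => rw [hga, ← mul_assoc]
    gcongr

/-- Lower bound of the glued density by `b ^ 2 * M`. -/
theorem glued_lower_bound {a b g M lam β : ℝ} (ha : 0 ≤ a) (hb : 0 ≤ b)
    (hM : 0 ≤ M) (hg0 : a = 0 → g = 0)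
    (hgM : β * a ^ 2 * M ≤ g ^ 2) :
    min β lam * (b ^ 2 * M) ≤
      (min a b / a * g) ^ 2 + lam * (b ^ 2 - min a b ^ 2) * M := by
  have hm1 : min β lam ≤ β := min_le_left _ _
  have hm2 : min β lam ≤ lam := min_le_right _ _
  rcases ha.eq_or_lt with h0 | h0
  · subst h0
    have : min 0 b = 0 := min_eq_left hb
    rw [this]
    have h3 : 0 ≤ b ^ 2 * M := by positivity
    simp
    nlinarith
  have e : (min a b / a * g) ^ 2 = (min a b / a) ^ 2 * g ^ 2 := by ring
  have h4 : (min a b / a) ^ 2 * (β * a ^ 2 * M) ≤ (min a b / a) ^ 2 * g ^ 2 := by gcongr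
  have h5 : (min a b / a) ^ 2 * (β * a ^ 2 * M) = β * (min a b ^ 2 * M) := by
    field_simp
  have h6 : 0 ≤ min a b ^ 2 * M := by positivity
  have h7 : min a b ^ 2 ≤ b ^ 2 := by
    gcongr
    exact min_le_right _ _
  have h8 : 0 ≤ (b ^ 2 - min a b ^ 2) * M := mul_nonneg (by linarith) hM
  rw [e]
  calc min β lam * (b ^ 2 * M)
      = min β lam * (min a b ^ 2 * M) + min β lam * ((b ^ 2 - min a b ^ 2) * M) := by ring
    _ ≤ β * (min a b ^ 2 * M) + lam * ((b ^ 2 - min a b ^ 2) * M) := by gcongr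
    _ ≤ _ := by linarith

/-- Here `a, b, g` stand for `√ρ, √σ, √Γ`. Multiplying `Q' - Q` by `Q' + Q` gives a difference of
squares. Its first part contains `q' + q ≤ Q' + Q`; its second contains `M (b' + b)`, which the
lower bound `√(min β lam) √M b ≤ Q` absorbs. -/
theorem abs_sqrt_glued_sub_le {lam β : ℝ} (hl : 0 ≤ lam) (hβ : 0 < β) :
    ∃ K : ℝ, 0 ≤ K ∧ ∀ a b a' b' g g' M : ℝ, 0 ≤ a → 0 ≤ b → 0 ≤ a' → 0 ≤ b' → 0 ≤ g →
      0 ≤ g' → 0 ≤ M → (a = 0 → g = 0) → (a' = 0 → g' = 0) →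
      β * a ^ 2 * M ≤ g ^ 2 → β * a' ^ 2 * M ≤ g' ^ 2 →
      |√((min a' b' / a' * g') ^ 2 + lam * (b' ^ 2 - min a' b' ^ 2) * M) -
        √((min a b / a * g) ^ 2 + lam * (b ^ 2 - min a b ^ 2) * M)| ≤
      |g' - g| + 2 * (|a' - a| + |b' - b|) * (g / a) + K * (|a' - a| + |b' - b|) * √M := by
  -- The factor `2 * lam` comes from the excess term, the root from dividing by the lower bound. For
  -- `lam = 0` the quotient is `0`, as the excess term is absent.
  refine ⟨2 * lam / √(min β lam), by positivity, ?_⟩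
  intro a b a' b' g g' M ha hb ha' hb' hg hg' hM h0 h0' hgM hgM'
  have hlow := glued_lower_bound (lam := lam) ha hb hM h0 hgM
  have hlow' := glued_lower_bound (lam := lam) ha' hb' hM h0' hgM'
  have hq := abs_min_div_mul_sub_le (g' := g') ha hb ha' hb' hg h0
  set q := min a b / a * g with hqdef
  set q' := min a' b' / a' * g' with hqdef'
  have hmb : min a b ^ 2 ≤ b ^ 2 := by gcongr; exact min_le_right _ _
  have hmb' : min a' b' ^ 2 ≤ b' ^ 2 := by gcongr; exact min_le_right _ _
  have hq0 : 0 ≤ q := by positivity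
  have hq0' : 0 ≤ q' := by positivity
  have hr : 0 ≤ lam * (b ^ 2 - min a b ^ 2) * M :=
    mul_nonneg (mul_nonneg hl (by linarith)) hM
  have hr' : 0 ≤ lam * (b' ^ 2 - min a' b' ^ 2) * M :=
    mul_nonneg (mul_nonneg hl (by linarith)) hM
  set Q := √(q ^ 2 + lam * (b ^ 2 - min a b ^ 2) * M) with hQ
  set Q' := √(q' ^ 2 + lam * (b' ^ 2 - min a' b' ^ 2) * M) with hQ'
  have hQs : Q ^ 2 = q ^ 2 + lam * (b ^ 2 - min a b ^ 2) * M := Real.sq_sqrt (by positivity)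
  have hQs' : Q' ^ 2 = q' ^ 2 + lam * (b' ^ 2 - min a' b' ^ 2) * M := Real.sq_sqrt (by positivity)
  have hQ0 : 0 ≤ Q := Real.sqrt_nonneg _
  have hQ0' : 0 ≤ Q' := Real.sqrt_nonneg _
  have hqQ : q ≤ Q := abs_le_of_sq_le_sq' (by linarith) hQ0 |>.2
  have hqQ' : q' ≤ Q' := abs_le_of_sq_le_sq' (by linarith) hQ0' |>.2
  set Δ := |a' - a| + |b' - b| with hΔ
  have hΔ0 : 0 ≤ Δ := by positivity
  have hga : 0 ≤ g / a := by positivity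
  rcases (add_nonneg hQ0' hQ0).eq_or_lt with hz | hpos
  · have : Q' - Q = 0 := by linarith
    rw [this, abs_zero]
    positivity
  suffices hs : |Q' - Q| * (Q' + Q) ≤
      (|g' - g| + 2 * Δ * (g / a) + 2 * lam / √(min β lam) * Δ * √M) * (Q' + Q) from
    le_of_mul_le_mul_right hs hpos
  have hm : |min a' b' - min a b| ≤ Δ :=
    (abs_min_sub_min_le_max a' b' a b).trans
      (max_le_add_of_nonneg (abs_nonneg _) (abs_nonneg _))
  have hbΔ : |b' - b| ≤ Δ := by rw [hΔ]; linarith [abs_nonneg (a' - a)]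
  have e : |Q' - Q| * (Q' + Q) = |(q' - q) * (q' + q) + lam * M * ((b' - b) * (b' + b) -
      (min a' b' - min a b) * (min a' b' + min a b))| := by
    rw [show |Q' - Q| * (Q' + Q) = |Q' - Q| * |Q' + Q| by rw [abs_of_pos hpos]]
    rw [← abs_mul]
    congr 1
    linear_combination hQs' - hQs
  have h1 : |(q' - q) * (q' + q)| ≤ (|g' - g| + 2 * Δ * (g / a)) * (Q' + Q) := by
    rw [abs_mul, abs_of_nonneg (add_nonneg hq0' hq0)]
    gcongr
  have hmm : min a' b' + min a b ≤ b' + b := add_le_add (min_le_right _ _) (min_le_right _ _)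
  have hmm0 : 0 ≤ min a' b' + min a b := by positivity
  have h2 : |(b' - b) * (b' + b) - (min a' b' - min a b) * (min a' b' + min a b)| ≤
      2 * Δ * (b' + b) := by
    refine (abs_sub _ _).trans ?_
    rw [abs_mul, abs_mul, abs_of_nonneg (add_nonneg hb' hb), abs_of_nonneg hmm0]
    calc _ ≤ Δ * (b' + b) + Δ * (b' + b) := by gcongr
      _ = _ := by ring
  have h3 : lam * M * (2 * Δ * (b' + b)) ≤ 2 * lam / √(min β lam) * Δ * √M * (Q' + Q) := by
    rcases hl.eq_or_lt with hl0 | hl0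
    · simp [← hl0]
    have hκ : 0 < min β lam := lt_min hβ hl0
    have hsq : ∀ {b Q : ℝ}, 0 ≤ b → 0 ≤ Q → min β lam * (b ^ 2 * M) ≤ Q ^ 2 →
        √(min β lam) * (√M * b) ≤ Q := by
      intro b Q hb hQ h
      refine abs_le_of_sq_le_sq' ?_ hQ |>.2
      rw [mul_pow, mul_pow, Real.sq_sqrt hκ.le, Real.sq_sqrt hM]
      linarith
    have hb1 := hsq hb hQ0 (by rw [hQs]; exact hlow)
    have hb1' := hsq hb' hQ0' (by rw [hQs']; exact hlow')
    have hκ' : 0 < √(min β lam) := Real.sqrt_pos.2 hκ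
    have hMM : M = √M * √M := (Real.mul_self_sqrt hM).symm
    have hsum : √M * (b' + b) ≤ (Q' + Q) / √(min β lam) := by
      rw [le_div_iff₀ hκ']; linarith
    calc lam * M * (2 * Δ * (b' + b)) = 2 * lam * Δ * √M * (√M * (b' + b)) := by
          conv_lhs => rw [hMM]
          ring
      _ ≤ 2 * lam * Δ * √M * ((Q' + Q) / √(min β lam)) := by gcongr
      _ = _ := by ring
  rw [e]
  calc _ ≤ |(q' - q) * (q' + q)| + |lam * M * ((b' - b) * (b' + b) -
      (min a' b' - min a b) * (min a' b' + min a b))| := abs_add_le _ _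
    _ ≤ (|g' - g| + 2 * Δ * (g / a)) * (Q' + Q) + lam * M * (2 * Δ * (b' + b)) := by
      rw [abs_mul (lam * M), abs_of_nonneg (mul_nonneg hl hM)]
      gcongr
    _ ≤ _ := by linarith

end Pointwise

/-! ### The reverse Minkowski inequality for square roots of densities. -/

section Minkowski

variable {Z : Type*} [MeasurableSpace Z]

theorem lintegral_enorm_sqrt_sq {μ : Measure Z} {F : Z → ℝ≥0∞} (hF : AEMeasurable F μ)
    (hfin : ∫⁻ z, F z ∂μ ≠ ⊤) :
    ∫⁻ z, ‖√(F z).toReal‖ₑ ^ 2 ∂μ = ∫⁻ z, F z ∂μ := by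
  refine lintegral_congr_ae ?_
  filter_upwards [ae_lt_top' hF hfin] with z hz
  rw [enorm_sq_eq_ofReal, Real.sq_sqrt ENNReal.toReal_nonneg, ENNReal.ofReal_toReal hz.ne]

theorem memLp_sqrt_toReal {μ : Measure Z} {F : Z → ℝ≥0∞} (hF : AEMeasurable F μ)
    (hfin : ∫⁻ z, F z ∂μ ≠ ⊤) :
    MemLp (fun z => √(F z).toReal) 2 μ := by
  refine ⟨hF.ennreal_toReal.sqrt.aestronglyMeasurable, ?_⟩
  rw [eLpNorm_lt_top_iff_lintegral_rpow_enorm_lt_top (by norm_num) (by norm_num)]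
  simp only [ENNReal.toReal_ofNat, ENNReal.rpow_ofNat]
  rw [lintegral_enorm_sqrt_sq hF hfin]
  exact hfin.lt_top

/-- Reverse Minkowski inequality for the `L²` norms of `√F` and `√F'`. -/
theorem enorm_sqrt_lintegral_sub_sq_le {μ : Measure Z} {F F' : Z → ℝ≥0∞}
    (hF : AEMeasurable F μ) (hF' : AEMeasurable F' μ)
    (hfin : ∫⁻ z, F z ∂μ ≠ ⊤) (hfin' : ∫⁻ z, F' z ∂μ ≠ ⊤) :
    ‖√(∫⁻ z, F' z ∂μ).toReal - √(∫⁻ z, F z ∂μ).toReal‖ₑ ^ 2 ≤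
      ∫⁻ z, ‖√(F' z).toReal - √(F z).toReal‖ₑ ^ 2 ∂μ := by
  have hs := memLp_sqrt_toReal hF hfin
  have hs' := memLp_sqrt_toReal hF' hfin'
  have hnorm : ∀ {F : Z → ℝ≥0∞} (hF : AEMeasurable F μ) (hfin : ∫⁻ z, F z ∂μ ≠ ⊤),
      √(∫⁻ z, F z ∂μ).toReal = ‖(memLp_sqrt_toReal hF hfin).toLp _‖ := by
    intro F hF hfin
    rw [Lp.norm_toLp, ← lintegral_enorm_sqrt_sq hF hfin]
    rw [lintegral_enorm_sq, ENNReal.toReal_pow, Real.sqrt_sq ENNReal.toReal_nonneg]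
  rw [hnorm hF hfin, hnorm hF' hfin']
  rw [lintegral_enorm_sq]
  gcongr
  have h3 : eLpNorm (fun z => √(F' z).toReal - √(F z).toReal) 2 μ =
      ‖hs'.toLp _ - hs.toLp _‖ₑ := by
    rw [← MemLp.toLp_sub, Lp.enorm_toLp]; rfl
  rw [h3, ← ofReal_norm, ← ofReal_norm, Real.norm_eq_abs]
  exact ENNReal.ofReal_le_ofReal (abs_norm_sub_norm_le _ _)

end Minkowski

/-! ### Null sets and translations on the product. -/

section Translation

theorem measurePreserving_translate_fst (v : R3) :
    MeasurePreserving (fun p : R3 × R3 => (p.1 + v, p.2)) volume volume := by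
  have := measurePreserving_add_right (volume : Measure (R3 × R3)) (v, 0)
  simpa [Prod.add_def] using this

theorem lintegral_prod_eq {f : R3 × R3 → ℝ≥0∞} (hf : Measurable f) :
    ∫⁻ p, f p = ∫⁻ x, ∫⁻ y, f (x, y) := by
  rw [Measure.volume_eq_prod, lintegral_prod _ hf.aemeasurable]

theorem ae_of_ae_ae {P : R3 × R3 → Prop} (hP : MeasurableSet {p | P p})
    (h : ∀ᵐ x, ∀ᵐ y, P (x, y)) : ∀ᵐ p, P p := by
  rw [Measure.volume_eq_prod]
  exact (Measure.ae_prod_iff_ae_ae hP).2 h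

theorem ae_fst {P : R3 → Prop} (h : ∀ᵐ x, P x) : ∀ᵐ p : R3 × R3, P p.1 := by
  rw [Measure.volume_eq_prod]
  exact Measure.quasiMeasurePreserving_fst.ae h

theorem ae_snd {P : R3 → Prop} (h : ∀ᵐ x, P x) : ∀ᵐ p : R3 × R3, P p.2 := by
  rw [Measure.volume_eq_prod]
  exact Measure.quasiMeasurePreserving_snd.ae h

end Translation

/-! ### Transfer of a density and its effect on translation energy. -/

section Transfer

/-- Transfer of a density by a plan: keep the share `h`, and redistribute the share `k` according
to the profile `l`. -/
noncomputable def transfer (h l k : R3 → ℝ≥0∞) (F : R3 → ℝ≥0∞) (w : R3) : ℝ≥0∞ :=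
  h w * F w + l w * ∫⁻ z, k z * F z

/-- `transfer` in the second variable. -/
noncomputable def transferSnd (h l k : R3 → ℝ≥0∞) (G : R3 × R3 → ℝ≥0∞) (p : R3 × R3) : ℝ≥0∞ :=
  transfer h l k (fun z => G (p.1, z)) p.2

/-- `transfer` in the first variable. -/
noncomputable def transferFst (h l k : R3 → ℝ≥0∞) (G : R3 × R3 → ℝ≥0∞) (p : R3 × R3) : ℝ≥0∞ :=
  transfer h l k (fun y => G (y, p.2)) p.1

variable {h l k : R3 → ℝ≥0∞}

theorem lintegral_transfer (hh : Measurable h) (hl : Measurable l) (hk : Measurable k)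
    {F : R3 → ℝ≥0∞} (hF : Measurable F) :
    ∫⁻ w, transfer h l k F w = ∫⁻ w, (h w + (∫⁻ z, l z) * k w) * F w := by
  simp only [transfer, add_mul, mul_assoc]
  rw [lintegral_add_left (by fun_prop), lintegral_add_left (by fun_prop),
    lintegral_mul_const _ hl, lintegral_const_mul _ (by fun_prop)]

/-- Seen as integration against one measure, a transfer falls under the reverse Minkowski
inequality. -/
theorem transfer_eq_lintegral (hk : Measurable k) {F : R3 → ℝ≥0∞}
    (hF : Measurable F) (w : R3) :
    transfer h l k F w =
      ∫⁻ z, F z ∂(h w • Measure.dirac w + l w • volume.withDensity k) := by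
  rw [lintegral_add_measure, lintegral_smul_measure, lintegral_smul_measure,
    lintegral_dirac' _ hF, lintegral_withDensity_eq_lintegral_mul _ hk hF]
  rfl

theorem measurable_transferSnd (hh : Measurable h) (hl : Measurable l) (hk : Measurable k)
    {G : R3 × R3 → ℝ≥0∞} (hG : Measurable G) : Measurable (transferSnd h l k G) := by
  have h1 : Measurable fun x : R3 => ∫⁻ z, k z * G (x, z) :=
    Measurable.lintegral_prod_right' (f := fun q : R3 × R3 => k q.2 * G q) (by fun_prop)
  unfold transferSnd transfer
  exact ((hh.comp measurable_snd).mul (by fun_prop)).add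
    ((hl.comp measurable_snd).mul (h1.comp measurable_fst))

theorem measurable_transferFst (hh : Measurable h) (hl : Measurable l) (hk : Measurable k)
    {G : R3 × R3 → ℝ≥0∞} (hG : Measurable G) : Measurable (transferFst h l k G) :=
  (measurable_transferSnd hh hl hk (hG.comp measurable_swap)).comp measurable_swap

theorem lintegral_transferSnd_le (hh : Measurable h) (hl : Measurable l) (hk : Measurable k)
    (hhk : ∀ᵐ w, h w + (∫⁻ z, l z) * k w ≤ 1) {G : R3 × R3 → ℝ≥0∞} (hG : Measurable G) :
    ∫⁻ p, transferSnd h l k G p ≤ ∫⁻ p, G p := by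
  rw [lintegral_prod_eq (measurable_transferSnd hh hl hk hG), lintegral_prod_eq hG]
  refine lintegral_mono fun x => ?_
  refine (lintegral_transfer hh hl hk (hG.comp measurable_prodMk_left)).trans_le ?_
  refine lintegral_mono_ae ?_
  filter_upwards [hhk] with w hw
  exact mul_le_of_le_one_left' hw

/-- A transfer in the second variable does not increase the translation energy in the first. -/
theorem LipschitzTranslatesFst.transferSnd (hh : Measurable h) (hl : Measurable l)
    (hk : Measurable k) (hhk : ∀ᵐ w, h w + (∫⁻ z, l z) * k w ≤ 1) {G : R3 × R3 → ℝ≥0∞}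
    (hG : Measurable G) (hfin : ∫⁻ p, G p ≠ ⊤)
    (hL : LipschitzTranslatesFst fun p => √(G p).toReal) :
    LipschitzTranslatesFst fun p => √(transferSnd h l k G p).toReal := by
  obtain ⟨C, hC⟩ := hL
  refine ⟨C, fun v => ?_⟩
  set D : R3 × R3 → ℝ≥0∞ := fun p => ‖√(G (p.1 + v, p.2)).toReal - √(G p).toReal‖ₑ ^ 2 with hD
  have hDm : Measurable D := by fun_prop
  have hSm := measurable_transferSnd hh hl hk hG
  have hae : ∀ᵐ p, GluedPlan.transferSnd h l k G p < ⊤ :=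
    ae_lt_top hSm ((lintegral_transferSnd_le hh hl hk hhk hG).trans_lt hfin.lt_top).ne
  -- The squared increments `D` are transferred in turn: the energy after the transfer is at most
  -- the mass of the transferred `D`, hence that of `D`.
  refine le_trans ?_ ((lintegral_transferSnd_le hh hl hk hhk hDm).trans (hC v))
  refine lintegral_mono_ae ?_
  filter_upwards [hae, (measurePreserving_translate_fst v).quasiMeasurePreserving.ae hae]
    with p h1 h2
  have m1 : Measurable fun z => G (p.1, z) := hG.comp measurable_prodMk_left
  have m2 : Measurable fun z => G (p.1 + v, z) := hG.comp measurable_prodMk_left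
  have m3 : Measurable fun z => D (p.1, z) := hDm.comp measurable_prodMk_left
  simp only [GluedPlan.transferSnd] at h1 h2 ⊢
  -- The measure depends on `p.2` alone, so it is the same at `p.1` and at `p.1 + v`.
  rw [transfer_eq_lintegral hk m1] at h1 ⊢
  rw [transfer_eq_lintegral hk m2] at h2 ⊢
  rw [transfer_eq_lintegral hk m3]
  exact enorm_sqrt_lintegral_sub_sq_le m1.aemeasurable m2.aemeasurable h1.ne h2.ne

end Transfer

/-! ### Translation energy of the glued density. -/

section Gluing

theorem three_add_sq_le (x y z : ℝ) : (x + y + z) ^ 2 ≤ 3 * x ^ 2 + 3 * y ^ 2 + 3 * z ^ 2 := by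
  nlinarith [sq_nonneg (x - y), sq_nonneg (y - z), sq_nonneg (x - z)]

theorem excess_eq_sq_sub_sq {ρ σ : R3 → ℝ} {x : R3} (hρ : 0 ≤ ρ x) (hσ : 0 ≤ σ x) :
    excess σ ρ x = √(σ x) ^ 2 - min √(ρ x) √(σ x) ^ 2 := by
  have h1 : min √(ρ x) √(σ x) = √(min (ρ x) (σ x)) :=
    (Monotone.map_min fun _ _ h => Real.sqrt_le_sqrt h).symm
  rw [h1, Real.sq_sqrt hσ, Real.sq_sqrt (le_min hρ hσ), excess, min_comm (σ x)]
  exact max_eq_left (by linarith [min_le_right (ρ x) (σ x)])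

/-- The square root of `min(ρ, σ)/ρ Γ + lam (σ - ρ)₊ M` has Lipschitz translates in the first
variable. -/
theorem lipschitzTranslatesFst_glued {ρ σ : R3 → ℝ} (hρ : Measurable ρ) (hσ : Measurable σ)
    (hρ0 : ∀ x, 0 ≤ ρ x) (hσ0 : ∀ x, 0 ≤ σ x)
    (Lρ : LipschitzTranslates fun x => √(ρ x)) (Lσ : LipschitzTranslates fun x => √(σ x))
    {Γ : R3 × R3 → ℝ≥0∞} (hΓ : Measurable Γ) (hΓfin : ∫⁻ p, Γ p ≠ ⊤)
    (hmarg : ∀ᵐ x, ∫⁻ w, Γ (x, w) ≤ ENNReal.ofReal (ρ x))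
    {M : R3 → ℝ≥0∞} (hM : Measurable M) (hMfin : ∫⁻ w, M w ≠ ⊤) {β lam : ℝ} (hβ : 0 < β)
    (hlam : 0 ≤ lam)
    (hpos : ∀ᵐ p : R3 × R3, ENNReal.ofReal β * ENNReal.ofReal (ρ p.1) * M p.2 ≤ Γ p)
    (LΓ : LipschitzTranslatesFst fun p => √(Γ p).toReal) :
    LipschitzTranslatesFst fun p => √(ENNReal.ofReal (min (ρ p.1) (σ p.1) / ρ p.1) * Γ p +
      ENNReal.ofReal (lam * excess σ ρ p.1) * M p.2).toReal := by
  obtain ⟨K, hK0, hK⟩ := abs_sqrt_glued_sub_le hlam hβ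
  obtain ⟨C₁, hC₁⟩ := Lρ
  obtain ⟨C₂, hC₂⟩ := Lσ
  obtain ⟨C₃, hC₃⟩ := LΓ
  -- The 3 comes from squaring three summands; the increments of `√ρ` and `√σ` carry a further 2
  -- from squaring their sum, whence `24 = 3 * 4 * 2` and `6 = 3 * 2`.
  refine ⟨3 * C₃ + 24 * (C₁ + C₂) +
    (6 * K ^ 2).toNNReal * ((C₁ + C₂) * (∫⁻ w, M w).toNNReal), fun v => ?_⟩
  set D : R3 → ℝ≥0∞ := fun x =>
    ‖√(ρ (x + v)) - √(ρ x)‖ₑ ^ 2 + ‖√(σ (x + v)) - √(σ x)‖ₑ ^ 2 with hD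
  have hDm : Measurable D := by fun_prop
  have hDint : ∫⁻ x, D x ≤ (C₁ + C₂) * ‖v‖ₑ ^ 2 := by
    rw [hD, lintegral_add_left (by fun_prop), add_mul]
    exact add_le_add (hC₁ v) (hC₂ v)
  have hΓtop : ∀ᵐ p, Γ p < ⊤ := ae_lt_top hΓ hΓfin
  have hMtop : ∀ᵐ p : R3 × R3, M p.2 < ⊤ := ae_snd (ae_lt_top hM hMfin)
  -- The marginal bound forces `Γ` to vanish over the zeros of `ρ`, which makes the quotients by `ρ`
  -- meaningful.
  have hzero : ∀ᵐ p : R3 × R3, ρ p.1 = 0 → Γ p = 0 := by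
    refine ae_of_ae_ae ?_ ?_
    · have : {p : R3 × R3 | ρ p.1 = 0 → Γ p = 0} =
          {p | ρ p.1 = 0}ᶜ ∪ {p | Γ p = 0} := by
        ext p; simp [imp_iff_not_or]
      rw [this]
      exact (measurableSet_eq_fun (by fun_prop) (by fun_prop)).compl.union
        (measurableSet_eq_fun (by fun_prop) (by fun_prop))
    · filter_upwards [hmarg] with x hx
      by_cases h0 : ρ x = 0
      · rw [h0, ENNReal.ofReal_zero, nonpos_iff_eq_zero,
          lintegral_eq_zero_iff (by fun_prop)] at hx
        filter_upwards [hx] with w hw _ using hw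
      · exact Eventually.of_forall fun w h => absurd h h0
  have hT := (measurePreserving_translate_fst v).quasiMeasurePreserving
  have hpt : ∀ᵐ p : R3 × R3,
      ‖√(ENNReal.ofReal (min (ρ (p.1 + v)) (σ (p.1 + v)) / ρ (p.1 + v)) * Γ (p.1 + v, p.2) +
        ENNReal.ofReal (lam * excess σ ρ (p.1 + v)) * M p.2).toReal -
      √(ENNReal.ofReal (min (ρ p.1) (σ p.1) / ρ p.1) * Γ p +
        ENNReal.ofReal (lam * excess σ ρ p.1) * M p.2).toReal‖ₑ ^ 2 ≤
      3 * ‖√(Γ (p.1 + v, p.2)).toReal - √(Γ p).toReal‖ₑ ^ 2 +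
        24 * (D p.1 * (ENNReal.ofReal (ρ p.1))⁻¹ * Γ p) +
        ENNReal.ofReal (6 * K ^ 2) * (D p.1 * M p.2) := by
    filter_upwards [hΓtop, hT.ae hΓtop, hMtop, hpos, hT.ae hpos, hzero, hT.ae hzero]
      with p t1 t2 t3 p1 p2 z1 z2
    have conv : ∀ x : R3, ∀ g : ℝ≥0∞, g < ⊤ →
        (ENNReal.ofReal (min (ρ x) (σ x) / ρ x) * g +
          ENNReal.ofReal (lam * excess σ ρ x) * M p.2).toReal =
        (min √(ρ x) √(σ x) / √(ρ x) * √g.toReal) ^ 2 +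
          lam * (√(σ x) ^ 2 - min √(ρ x) √(σ x) ^ 2) * (M p.2).toReal := by
      intro x g hg
      have h1 : min √(ρ x) √(σ x) = √(min (ρ x) (σ x)) :=
        (Monotone.map_min fun _ _ h => Real.sqrt_le_sqrt h).symm
      have h2 : 0 ≤ min (ρ x) (σ x) := le_min (hρ0 x) (hσ0 x)
      have h3 : 0 ≤ excess σ ρ x := le_max_right _ _
      rw [← excess_eq_sq_sub_sq (hρ0 x) (hσ0 x), ENNReal.toReal_add
        (ENNReal.mul_ne_top ENNReal.ofReal_ne_top hg.ne)
        (ENNReal.mul_ne_top ENNReal.ofReal_ne_top t3.ne), ENNReal.toReal_mul, ENNReal.toReal_mul,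
        ENNReal.toReal_ofReal (div_nonneg h2 (hρ0 x)), ENNReal.toReal_ofReal (by positivity),
        h1, mul_pow, div_pow, Real.sq_sqrt h2, Real.sq_sqrt (hρ0 x),
        Real.sq_sqrt ENNReal.toReal_nonneg]
    have low : ∀ x : R3, ∀ g : ℝ≥0∞, g < ⊤ →
        ENNReal.ofReal β * ENNReal.ofReal (ρ x) * M p.2 ≤ g →
        β * √(ρ x) ^ 2 * (M p.2).toReal ≤ √g.toReal ^ 2 := by
      intro x g hg h
      have := ENNReal.toReal_mono hg.ne h
      rwa [ENNReal.toReal_mul, ENNReal.toReal_mul, ENNReal.toReal_ofReal hβ.le,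
        ENNReal.toReal_ofReal (hρ0 x), ← Real.sq_sqrt (hρ0 x),
        ← Real.sq_sqrt (ENNReal.toReal_nonneg (a := g))] at this
    have zer : ∀ x : R3, ∀ g : ℝ≥0∞, (ρ x = 0 → g = 0) → √(ρ x) = 0 → √g.toReal = 0 := by
      intro x g h h0
      rw [h ((Real.sqrt_eq_zero (hρ0 x)).1 h0)]; simp
    rw [conv _ _ t1, conv _ _ t2]
    have key := hK √(ρ p.1) √(σ p.1) √(ρ (p.1 + v)) √(σ (p.1 + v)) √(Γ p).toReal
      √(Γ (p.1 + v, p.2)).toReal (M p.2).toReal (Real.sqrt_nonneg _) (Real.sqrt_nonneg _)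
      (Real.sqrt_nonneg _) (Real.sqrt_nonneg _) (Real.sqrt_nonneg _) (Real.sqrt_nonneg _)
      ENNReal.toReal_nonneg (zer _ _ z1) (zer _ _ z2) (low _ _ t1 p1) (low _ _ t2 p2)
    have hΓρ : Γ p = 0 ∨ 0 < ρ p.1 := by
      rcases (hρ0 p.1).eq_or_lt with h | h
      · exact Or.inl (z1 h.symm)
      · exact Or.inr h
    have hquot : (ENNReal.ofReal (ρ p.1))⁻¹ * Γ p =
        ENNReal.ofReal ((√(Γ p).toReal / √(ρ p.1)) ^ 2) := by
      rw [div_pow, Real.sq_sqrt ENNReal.toReal_nonneg, Real.sq_sqrt (hρ0 p.1)]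
      rcases hΓρ with h | h
      · simp [h]
      · rw [ENNReal.ofReal_div_of_pos h, ENNReal.ofReal_toReal t1.ne, ENNReal.div_eq_inv_mul]
    have hMr : M p.2 = ENNReal.ofReal (√(M p.2).toReal ^ 2) := by
      rw [Real.sq_sqrt ENNReal.toReal_nonneg, ENNReal.ofReal_toReal t3.ne]
    rw [mul_assoc (D p.1), hquot]
    rw [show D p.1 * M p.2 = D p.1 * ENNReal.ofReal (√(M p.2).toReal ^ 2) by rw [← hMr]]
    simp only [hD, enorm_sq_eq_ofReal]
    generalize √(Γ p).toReal / √(ρ p.1) = r at *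
    generalize √(M p.2).toReal = m at *
    generalize √(ρ (p.1 + v)) - √(ρ p.1) = da at *
    generalize √(σ (p.1 + v)) - √(σ p.1) = db at *
    generalize √(Γ (p.1 + v, p.2)).toReal - √(Γ p).toReal = dg at *
    rw [← ENNReal.ofReal_add (by positivity) (by positivity),
      ← ENNReal.ofReal_mul (by positivity), ← ENNReal.ofReal_mul (by positivity),
      ← ENNReal.ofReal_mul (by positivity), show (3 : ℝ≥0∞) = ENNReal.ofReal 3 by simp,
      show (24 : ℝ≥0∞) = ENNReal.ofReal 24 by simp, ← ENNReal.ofReal_mul (by positivity),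
      ← ENNReal.ofReal_mul (by positivity), ← ENNReal.ofReal_add (by positivity) (by positivity),
      ← ENNReal.ofReal_add (by positivity) (by positivity)]
    refine ENNReal.ofReal_le_ofReal ?_
    rw [← sq_abs]
    have hab : (|da| + |db|) ^ 2 ≤ 2 * (da ^ 2 + db ^ 2) := by
      rw [← sq_abs da, ← sq_abs db]; exact add_sq_le
    calc _ ≤ _ := pow_le_pow_left₀ (abs_nonneg _) key 2
      _ ≤ _ := three_add_sq_le _ _ _
      _ = 3 * dg ^ 2 + 12 * ((|da| + |db|) ^ 2 * r ^ 2) +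
          3 * K ^ 2 * ((|da| + |db|) ^ 2 * m ^ 2) := by rw [sq_abs]; ring
      _ ≤ 3 * dg ^ 2 + 12 * ((2 * (da ^ 2 + db ^ 2)) * r ^ 2) +
          3 * K ^ 2 * ((2 * (da ^ 2 + db ^ 2)) * m ^ 2) := by gcongr
      _ = _ := by ring
  -- Integrating in the second variable first replaces `Γ` by its marginal, which cancels the weight
  -- `1/ρ`.
  have hint1 : ∫⁻ p : R3 × R3, D p.1 * (ENNReal.ofReal (ρ p.1))⁻¹ * Γ p ≤ ∫⁻ x, D x := by
    rw [lintegral_prod_eq (by fun_prop)]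
    refine lintegral_mono_ae ?_
    filter_upwards [hmarg] with x hx
    rw [lintegral_const_mul _ (by fun_prop), mul_assoc]
    calc _ ≤ D x * ((ENNReal.ofReal (ρ x))⁻¹ * ENNReal.ofReal (ρ x)) := by gcongr
      _ ≤ D x * 1 := by gcongr; exact ENNReal.inv_mul_le_one _
      _ = D x := mul_one _
  have hint2 : ∫⁻ p : R3 × R3, D p.1 * M p.2 = (∫⁻ x, D x) * ∫⁻ w, M w := by
    rw [Measure.volume_eq_prod, lintegral_prod_mul hDm.aemeasurable hM.aemeasurable]
  refine (lintegral_mono_ae hpt).trans ?_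
  rw [lintegral_add_left (by fun_prop), lintegral_add_left (by fun_prop),
    lintegral_const_mul _ (by fun_prop), lintegral_const_mul _ (by fun_prop),
    lintegral_const_mul _ (by fun_prop), hint2]
  have h3 := hC₃ v
  calc _ ≤ 3 * (C₃ * ‖v‖ₑ ^ 2) + 24 * ((C₁ + C₂) * ‖v‖ₑ ^ 2) +
        ENNReal.ofReal (6 * K ^ 2) * ((C₁ + C₂) * ‖v‖ₑ ^ 2 * ∫⁻ w, M w) := by
        gcongr
        exact hint1.trans hDint
    _ = _ := by
      push_cast
      rw [ENNReal.coe_toNNReal hMfin, ENNReal.ofReal]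
      ring

end Gluing

/-! ### Monotonicity, marginals and symmetry of transfers. -/

section TransferLemmas

variable {h l k : R3 → ℝ≥0∞}

theorem transfer_mono_ae {F F' : R3 → ℝ≥0∞} (hF : ∀ᵐ z, F z ≤ F' z) :
    ∀ᵐ w, transfer h l k F w ≤ transfer h l k F' w := by
  have : ∫⁻ z, k z * F z ≤ ∫⁻ z, k z * F' z := by
    refine lintegral_mono_ae ?_
    filter_upwards [hF] with z hz
    gcongr
  filter_upwards [hF] with w hw
  unfold transfer
  gcongr

theorem transfer_congr_ae {F F' : R3 → ℝ≥0∞} (hF : ∀ᵐ z, F z = F' z) :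
    ∀ᵐ w, transfer h l k F w = transfer h l k F' w := by
  filter_upwards [transfer_mono_ae (h := h) (l := l) (k := k) (hF.mono fun _ h => h.le),
    transfer_mono_ae (h := h) (l := l) (k := k) (hF.mono fun _ h => h.ge)] with w h1 h2
  exact le_antisymm h1 h2

theorem transfer_const_mul (hk : Measurable k) {F : R3 → ℝ≥0∞} (hF : Measurable F) (c : ℝ≥0∞)
    (w : R3) : transfer h l k (fun z => c * F z) w = c * transfer h l k F w := by
  have : ∫⁻ z, k z * (c * F z) = c * ∫⁻ z, k z * F z := by
    rw [← lintegral_const_mul _ (by fun_prop)]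
    exact lintegral_congr fun z => by ring
  simp only [transfer, this]
  ring

theorem lintegral_transferSnd_fst (hk : Measurable k)
    {G : R3 × R3 → ℝ≥0∞} (hG : Measurable G) (w : R3) :
    ∫⁻ y, transferSnd h l k G (y, w) = transfer h l k (fun z => ∫⁻ y, G (y, z)) w := by
  have hm : Measurable fun y : R3 => ∫⁻ z, k z * G (y, z) :=
    Measurable.lintegral_prod_right' (f := fun q : R3 × R3 => k q.2 * G q) (by fun_prop)
  simp only [transferSnd, transfer]
  rw [lintegral_add_left (by fun_prop), lintegral_const_mul _ (by fun_prop),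
    lintegral_const_mul _ hm, lintegral_lintegral_swap (by fun_prop)]
  congr 2
  exact lintegral_congr fun z => lintegral_const_mul _ (by fun_prop)

theorem lintegral_transferFst_snd (hk : Measurable k)
    {G : R3 × R3 → ℝ≥0∞} (hG : Measurable G) (x : R3) :
    ∫⁻ w, transferFst h l k G (x, w) = transfer h l k (fun y => ∫⁻ w, G (y, w)) x :=
  lintegral_transferSnd_fst hk (hG.comp measurable_swap) x

/-- Transfers in the two variables commute by Fubini. This symmetry lets every statement on the
first variable serve for the second. -/
theorem transferFst_transferSnd_comm (hk : Measurable k)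
    {G : R3 × R3 → ℝ≥0∞} (hG : Measurable G) (p : R3 × R3) :
    transferFst h l k (transferSnd h l k G) p =
      transferFst h l k (transferSnd h l k fun q => G q.swap) p.swap := by
  have hm : Measurable fun y : R3 => ∫⁻ z, k z * G (y, z) :=
    Measurable.lintegral_prod_right' (f := fun q : R3 × R3 => k q.2 * G q) (by fun_prop)
  have hm' : Measurable fun z : R3 => ∫⁻ y, k y * G (y, z) :=
    Measurable.lintegral_prod_left' (f := fun q : R3 × R3 => k q.1 * G q) (by fun_prop)
  simp only [transferFst, transferSnd, transfer, Prod.swap_prod_mk, Prod.fst_swap, Prod.snd_swap]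
  have e1 : ∫⁻ y, k y * (h p.2 * G (y, p.2) + l p.2 * ∫⁻ z, k z * G (y, z)) =
      h p.2 * (∫⁻ y, k y * G (y, p.2)) + l p.2 * ∫⁻ y, k y * ∫⁻ z, k z * G (y, z) := by
    rw [← lintegral_const_mul _ (by fun_prop), ← lintegral_const_mul _ (by fun_prop),
      ← lintegral_add_left (by fun_prop)]
    exact lintegral_congr fun y => by ring
  have e2 : ∫⁻ z, k z * (h p.1 * G (p.1, z) + l p.1 * ∫⁻ y, k y * G (y, z)) =
      h p.1 * (∫⁻ z, k z * G (p.1, z)) + l p.1 * ∫⁻ z, k z * ∫⁻ y, k y * G (y, z) := by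
    rw [← lintegral_const_mul _ (by fun_prop), ← lintegral_const_mul _ (by fun_prop),
      ← lintegral_add_left (by fun_prop)]
    exact lintegral_congr fun y => by ring
  have e3 : ∫⁻ y, k y * ∫⁻ z, k z * G (y, z) = ∫⁻ z, k z * ∫⁻ y, k y * G (y, z) := by
    have c1 : ∀ y, k y * ∫⁻ z, k z * G (y, z) = ∫⁻ z, k y * (k z * G (y, z)) := fun y =>
      (lintegral_const_mul _ (by fun_prop)).symm
    have c2 : ∀ z, k z * ∫⁻ y, k y * G (y, z) = ∫⁻ y, k z * (k y * G (y, z)) := fun z =>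
      (lintegral_const_mul _ (by fun_prop)).symm
    simp only [c1, c2]
    rw [lintegral_lintegral_swap (by fun_prop)]
    exact lintegral_congr fun z => lintegral_congr fun y => by ring
  rw [e1, e2, e3]
  ring

end TransferLemmas

/-! ### The coefficients of the transfer given by a basic plan. -/

section Coefficients

variable {ρ σ : R3 → ℝ}

/-- The share of the mass that stays. -/
noncomputable def keepShare (ρ σ : R3 → ℝ) (x : R3) : ℝ≥0∞ :=
  ENNReal.ofReal (min (ρ x) (σ x) / ρ x)

/-- The share of the mass that is moved. -/
noncomputable def moveShare (ρ σ : R3 → ℝ) (x : R3) : ℝ≥0∞ :=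
  ENNReal.ofReal (excess ρ σ x / ρ x)

/-- The profile according to which the moved mass is redistributed. -/
noncomputable def refill (ρ σ : R3 → ℝ) (x : R3) : ℝ≥0∞ :=
  ENNReal.ofReal ((∫ y, excess σ ρ y)⁻¹ * excess σ ρ x)

theorem excess_nonneg (ρ σ : R3 → ℝ) (x : R3) : 0 ≤ excess ρ σ x := le_max_right _ _

theorem min_add_excess (ρ σ : R3 → ℝ) (x : R3) : min (ρ x) (σ x) + excess ρ σ x = ρ x := by
  rw [excess, max_eq_left (by linarith [min_le_left (ρ x) (σ x)])]
  ring

theorem measurable_excess (hρ : Measurable ρ) (hσ : Measurable σ) : Measurable (excess ρ σ) := by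
  unfold excess; fun_prop

theorem measurable_keepShare (hρ : Measurable ρ) (hσ : Measurable σ) :
    Measurable (keepShare ρ σ) := by
  unfold keepShare; fun_prop

theorem measurable_moveShare (hρ : Measurable ρ) (hσ : Measurable σ) :
    Measurable (moveShare ρ σ) :=
  ((measurable_excess hρ hσ).div hρ).ennreal_ofReal

theorem measurable_refill (hρ : Measurable ρ) (hσ : Measurable σ) :
    Measurable (refill ρ σ) :=
  ((measurable_excess hσ hρ).const_mul _).ennreal_ofReal

theorem integrable_excess (hρ : Integrable ρ) (hσ : Integrable σ) :
    Integrable (excess ρ σ) :=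
  (hρ.sub (hρ.inf hσ)).pos_part

/-- Each excess is what remains of its density after removing the common minimum, and the masses are
equal. -/
theorem integral_excess_comm (hρ : Integrable ρ) (hσ : Integrable σ)
    (hmass : ∫ x, ρ x = ∫ x, σ x) : ∫ x, excess σ ρ x = ∫ x, excess ρ σ x := by
  have h1 : ∫ x, (excess σ ρ x - excess ρ σ x) = ∫ x, (σ x - ρ x) := by
    refine integral_congr_ae (Eventually.of_forall fun x => ?_)
    have e1 := min_add_excess ρ σ x
    have e2 := min_add_excess σ ρ x
    rw [min_comm] at e2
    simp only
    linarith
  rw [integral_sub (integrable_excess hσ hρ) (integrable_excess hρ hσ),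
    integral_sub hσ hρ] at h1
  linarith

theorem lintegral_excess (hρ : Integrable ρ) (hσ : Integrable σ) :
    ∫⁻ x, ENNReal.ofReal (excess ρ σ x) = ENNReal.ofReal (∫ x, excess ρ σ x) :=
  (ofReal_integral_eq_lintegral_ofReal (integrable_excess hρ hσ)
    (Eventually.of_forall (excess_nonneg ρ σ))).symm

/-- If the total excess vanishes, then so does the excess. -/
theorem inv_integral_mul_integral_excess_ae (hρ : Integrable ρ) (hσ : Integrable σ) :
    ∀ᵐ x, (∫ y, excess ρ σ y)⁻¹ * (∫ y, excess ρ σ y) * excess ρ σ x = excess ρ σ x := by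
  by_cases hc : ∫ y, excess ρ σ y = 0
  · have := (integral_eq_zero_iff_of_nonneg (excess_nonneg ρ σ) (integrable_excess hρ hσ)).1 hc
    filter_upwards [this] with x hx
    rw [hx]; simp
  · exact Eventually.of_forall fun x => by rw [inv_mul_cancel₀ hc, one_mul]

theorem lintegral_refill (hρ : Integrable ρ) (hσ : Integrable σ) :
    ∫⁻ x, refill ρ σ x =
      ENNReal.ofReal ((∫ y, excess σ ρ y)⁻¹ * ∫ y, excess σ ρ y) := by
  have h0 : 0 ≤ ∫ y, excess σ ρ y := integral_nonneg (excess_nonneg σ ρ)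
  unfold refill
  simp only [ENNReal.ofReal_mul (inv_nonneg.2 h0)]
  rw [lintegral_const_mul' _ _ ENNReal.ofReal_ne_top, lintegral_excess hσ hρ]

/-- The total of `refill` is 1 unless there is no excess, in which case `moveShare` vanishes almost
everywhere. The right side is the indicator of `ρ > 0`, by the convention `0 / 0 = 0`. -/
theorem keepShare_add_eq (hρ0 : ∀ x, 0 ≤ ρ x) (hσ0 : ∀ x, 0 ≤ σ x) (hρ : Integrable ρ)
    (hσ : Integrable σ) (hmass : ∫ x, ρ x = ∫ x, σ x) :
    ∀ᵐ x, keepShare ρ σ x + (∫⁻ z, refill ρ σ z) * moveShare ρ σ x =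
      ENNReal.ofReal (ρ x / ρ x) := by
  have hc : 0 ≤ (∫ y, excess σ ρ y)⁻¹ * ∫ y, excess σ ρ y := by
    have h0 : 0 ≤ ∫ y, excess σ ρ y := integral_nonneg (excess_nonneg σ ρ)
    positivity
  filter_upwards [inv_integral_mul_integral_excess_ae hρ hσ] with x hx
  rw [lintegral_refill hρ hσ, keepShare, moveShare, ← ENNReal.ofReal_mul hc,
    ← ENNReal.ofReal_add (div_nonneg (le_min (hρ0 x) (hσ0 x)) (hρ0 x))
      (mul_nonneg hc (div_nonneg (excess_nonneg ρ σ x) (hρ0 x))),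
    ← mul_div_assoc, integral_excess_comm hρ hσ hmass, hx, ← add_div, min_add_excess]

theorem keepShare_add_le (hρ0 : ∀ x, 0 ≤ ρ x) (hσ0 : ∀ x, 0 ≤ σ x) (hρ : Integrable ρ)
    (hσ : Integrable σ) (hmass : ∫ x, ρ x = ∫ x, σ x) :
    ∀ᵐ x, keepShare ρ σ x + (∫⁻ z, refill ρ σ z) * moveShare ρ σ x ≤ 1 := by
  filter_upwards [keepShare_add_eq hρ0 hσ0 hρ hσ hmass] with x hx
  rw [hx]
  exact ENNReal.ofReal_le_one.2 (div_self_le_one _)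

theorem moveShare_le_one (hρ0 : ∀ x, 0 ≤ ρ x) (hσ0 : ∀ x, 0 ≤ σ x) (x : R3) :
    moveShare ρ σ x ≤ 1 := by
  refine ENNReal.ofReal_le_one.2 (div_le_one_of_le₀ ?_ (hρ0 x))
  linarith [min_add_excess ρ σ x, le_min (hρ0 x) (hσ0 x)]

theorem div_self_mul_of_le {a m : ℝ} (hm0 : 0 ≤ m) (hma : m ≤ a) : m / a * a = m := by
  rcases (hm0.trans hma).eq_or_lt with h | h
  · have : m = 0 := le_antisymm (hma.trans h.symm.le) hm0
    simp [this]
  · field_simp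

/-- The kept part is `min(ρ, σ)`, and the moved mass equals the total excess of `σ`, so the refill
restores exactly that excess. -/
theorem transfer_density (hρ0 : ∀ x, 0 ≤ ρ x) (hσ0 : ∀ x, 0 ≤ σ x) (hρ : Integrable ρ)
    (hσ : Integrable σ) (hmass : ∫ x, ρ x = ∫ x, σ x) :
    ∀ᵐ x, transfer (keepShare ρ σ) (refill ρ σ) (moveShare ρ σ)
      (fun z => ENNReal.ofReal (ρ z)) x = ENNReal.ofReal (σ x) := by
  have h0 : 0 ≤ ∫ y, excess σ ρ y := integral_nonneg (excess_nonneg σ ρ)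
  have e1 : ∫⁻ z, moveShare ρ σ z * ENNReal.ofReal (ρ z) =
      ENNReal.ofReal (∫ y, excess σ ρ y) := by
    rw [integral_excess_comm hρ hσ hmass, ← lintegral_excess hρ hσ]
    refine lintegral_congr fun z => ?_
    have hle : excess ρ σ z ≤ ρ z := by
      linarith [min_add_excess ρ σ z, le_min (hρ0 z) (hσ0 z)]
    rw [moveShare, ← ENNReal.ofReal_mul (div_nonneg (excess_nonneg _ _ _) (hρ0 z)),
      div_self_mul_of_le (excess_nonneg _ _ _) hle]
  filter_upwards [inv_integral_mul_integral_excess_ae hσ hρ] with x hx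
  have hm : 0 ≤ min (ρ x) (σ x) := le_min (hρ0 x) (hσ0 x)
  have hr : 0 ≤ (∫ y, excess σ ρ y)⁻¹ * excess σ ρ x :=
    mul_nonneg (inv_nonneg.2 h0) (excess_nonneg _ _ _)
  rw [transfer, e1, keepShare, refill, ← ENNReal.ofReal_mul (div_nonneg hm (hρ0 x)),
    ← ENNReal.ofReal_mul hr, div_self_mul_of_le hm (min_le_left _ _),
    ← ENNReal.ofReal_add hm (mul_nonneg hr h0), mul_right_comm, hx, min_comm, min_add_excess]

end Coefficients

/-! ### The combined plan as a double transfer. -/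

section Plan

variable {ρ σ : R3 → ℝ}

instance sFinite_densityMeasure {F : Type*} [MeasureSpace F] [SFinite (volume : Measure F)]
    (ρ : F → ℝ) : SFinite (densityMeasure ρ) :=
  inferInstanceAs (SFinite (volume.withDensity _))

instance sFinite_basicPlan (ρ σ : R3 → ℝ) : SFinite (basicPlan ρ σ) := by
  have : SFinite (volume : Measure (R3 × R3)) :=
    inferInstanceAs (SFinite ((volume : Measure R3).prod volume))
  exact inferInstanceAs (SFinite (_ + _))

theorem lintegral_basicPlan (hρ : Measurable ρ) (hσ : Measurable σ) {Φ : R3 × R3 → ℝ≥0∞}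
    (hΦ : Measurable Φ) :
    ∫⁻ q, Φ q ∂basicPlan ρ σ = (∫⁻ x, ENNReal.ofReal (min (ρ x) (σ x)) * Φ (x, x)) +
      ∫⁻ p : R3 × R3, ENNReal.ofReal (excess ρ σ p.1 * excess σ ρ p.2 / ∫ y, excess σ ρ y) *
        Φ p := by
  have m1 := measurable_excess hρ hσ
  have m2 := measurable_excess hσ hρ
  rw [basicPlan, lintegral_add_measure, lintegral_map hΦ (by fun_prop), densityMeasure,
    densityMeasure, lintegral_withDensity_eq_lintegral_mul _ (by fun_prop) (by fun_prop),
    lintegral_withDensity_eq_lintegral_mul _ (by fun_prop) hΦ]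
  rfl

theorem basicPlan_map_swap (hρ : Measurable ρ) (hσ : Measurable σ)
    (hc : ∫ x, excess σ ρ x = ∫ x, excess ρ σ x) :
    basicPlan σ ρ = (basicPlan ρ σ).map Prod.swap := by
  refine Measure.ext_of_lintegral _ fun Φ hΦ => ?_
  rw [lintegral_map hΦ measurable_swap, lintegral_basicPlan hσ hρ hΦ,
    lintegral_basicPlan (Φ := fun q => Φ q.swap) hρ hσ (by fun_prop), ← lintegral_comp_swap, hc]
  simp only [min_comm (σ _), Prod.fst_swap, Prod.snd_swap, Prod.swap_prod_mk,
    mul_comm (excess σ ρ _)]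

theorem invOnPos_eq_inv (hρ0 : ∀ x, 0 ≤ ρ x) (x : R3) : invOnPos ρ x = (ρ x)⁻¹ := by
  unfold invOnPos
  split_ifs with h
  · simp
  · rw [le_antisymm (not_lt.1 h) (hρ0 x), inv_zero]

theorem measurable_invOnPos (hρ : Measurable ρ) (hρ0 : ∀ x, 0 ≤ ρ x) :
    Measurable (invOnPos ρ) := by
  rw [funext (invOnPos_eq_inv hρ0)]; exact hρ.inv

/-- Disintegration of the plan: the diagonal part gives `keepShare`, and the product part splits
into `moveShare` at the source and `refill` at the target. -/
theorem lintegral_basicPlan_transfer (hρ : Measurable ρ) (hσ : Measurable σ)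
    (hρ0 : ∀ x, 0 ≤ ρ x) (hσ0 : ∀ x, 0 ≤ σ x) {φ F : R3 → ℝ≥0∞} (hφ : Measurable φ)
    (hF : Measurable F) :
    ∫⁻ q, φ q.2 * (ENNReal.ofReal (invOnPos ρ q.1) * F q.1) ∂basicPlan ρ σ =
      ∫⁻ w, φ w * transfer (keepShare ρ σ) (refill ρ σ) (moveShare ρ σ) F w := by
  have m1 := measurable_excess hρ hσ
  have m2 := measurable_excess hσ hρ
  have m3 := measurable_invOnPos hρ hρ0
  have m4 := measurable_keepShare hρ hσ
  have m5 := measurable_moveShare hρ hσ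
  have m6 := measurable_refill hρ hσ
  have h0 : 0 ≤ ∫ y, excess σ ρ y := integral_nonneg (excess_nonneg σ ρ)
  rw [lintegral_basicPlan hρ hσ (by fun_prop)]
  simp only [transfer, mul_add]
  rw [lintegral_add_left (by fun_prop)]
  congr 1
  · refine lintegral_congr fun x => ?_
    rw [keepShare, invOnPos_eq_inv hρ0, div_eq_mul_inv,
      ENNReal.ofReal_mul (le_min (hρ0 x) (hσ0 x))]
    ring
  · have e : ∀ p : R3 × R3,
        ENNReal.ofReal (excess ρ σ p.1 * excess σ ρ p.2 / ∫ y, excess σ ρ y) *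
          (φ p.2 * (ENNReal.ofReal (invOnPos ρ p.1) * F p.1)) =
        (moveShare ρ σ p.1 * F p.1) * (φ p.2 * refill ρ σ p.2) := by
      intro p
      rw [moveShare, refill, invOnPos_eq_inv hρ0, div_eq_mul_inv, div_eq_mul_inv,
        ENNReal.ofReal_mul (mul_nonneg (excess_nonneg _ _ _) (excess_nonneg _ _ _)),
        ENNReal.ofReal_mul (excess_nonneg _ _ _), ENNReal.ofReal_mul (excess_nonneg _ _ _),
        ENNReal.ofReal_mul (inv_nonneg.2 h0)]
      ring
    simp only [e]
    rw [Measure.volume_eq_prod, lintegral_prod_mul (f := fun x => moveShare ρ σ x * F x)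
      (g := fun w => φ w * refill ρ σ w) (by fun_prop) (by fun_prop), mul_comm,
      ← lintegral_mul_const _ (by fun_prop)]
    exact lintegral_congr fun w => by ring

theorem lintegral_basicPlan_swap_transfer (hρ : Measurable ρ) (hσ : Measurable σ)
    (hρ0 : ∀ x, 0 ≤ ρ x) (hσ0 : ∀ x, 0 ≤ σ x)
    (hc : ∫ x, excess σ ρ x = ∫ x, excess ρ σ x) {φ F : R3 → ℝ≥0∞} (hφ : Measurable φ)
    (hF : Measurable F) :
    ∫⁻ q, φ q.1 * (ENNReal.ofReal (invOnPos ρ q.2) * F q.2) ∂basicPlan σ ρ =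
      ∫⁻ w, φ w * transfer (keepShare ρ σ) (refill ρ σ) (moveShare ρ σ) F w := by
  have m3 := measurable_invOnPos hρ hρ0
  rw [basicPlan_map_swap hρ hσ hc, lintegral_map (by fun_prop) measurable_swap]
  exact lintegral_basicPlan_transfer hρ hσ hρ0 hσ0 hφ hF

/-- The density of the combined plan. -/
noncomputable def combinedDensity (ρ σ : R3 → ℝ) (G : R3 × R3 → ℝ≥0∞) : R3 × R3 → ℝ≥0∞ :=
  transferFst (keepShare ρ σ) (refill ρ σ) (moveShare ρ σ)
    (transferSnd (keepShare ρ σ) (refill ρ σ) (moveShare ρ σ) G)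

theorem measurable_combinedDensity (hρ : Measurable ρ) (hσ : Measurable σ)
    {G : R3 × R3 → ℝ≥0∞} (hG : Measurable G) : Measurable (combinedDensity ρ σ G) :=
  measurable_transferFst (measurable_keepShare hρ hσ) (measurable_refill hρ hσ)
    (measurable_moveShare hρ hσ) (measurable_transferSnd (measurable_keepShare hρ hσ)
      (measurable_refill hρ hσ) (measurable_moveShare hρ hσ) hG)

theorem combinedDensity_swap (hρ : Measurable ρ) (hσ : Measurable σ)
    {G : R3 × R3 → ℝ≥0∞} (hG : Measurable G) (p : R3 × R3) :
    combinedDensity ρ σ G p = combinedDensity ρ σ (fun q => G q.swap) p.swap :=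
  transferFst_transferSnd_comm (measurable_moveShare hρ hσ) hG p

/-- Against a test function, integrating out the plan from `ρ` to `σ` is the transfer in the second
variable; the opposite plan is its reflection, so integrating it out is the transfer in the first.
The singular diagonals thereby disappear. -/
theorem combinedPlan_eq_withDensity (hρ : Measurable ρ) (hσ : Measurable σ)
    (hρ0 : ∀ x, 0 ≤ ρ x) (hσ0 : ∀ x, 0 ≤ σ x)
    (hc : ∫ x, excess σ ρ x = ∫ x, excess ρ σ x) (γ : Measure (R3 × R3)) :
    combinedPlan ρ σ γ = volume.withDensity (combinedDensity ρ σ (γ.rnDeriv volume)) := by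
  have hG : Measurable (γ.rnDeriv volume) := Measure.measurable_rnDeriv γ volume
  set G := γ.rnDeriv volume with hGdef
  have m3 := measurable_invOnPos hρ hρ0
  have m4 := measurable_keepShare hρ hσ
  have m5 := measurable_moveShare hρ hσ
  have m6 := measurable_refill hρ hσ
  have mS := measurable_transferSnd m4 m6 m5 hG
  have mP := measurable_combinedDensity hρ hσ hG
  refine Measure.ext_of_lintegral _ fun Φ hΦ => ?_
  rw [combinedPlan, lintegral_map hΦ (by fun_prop),
    lintegral_withDensity_eq_lintegral_mul _ (by fun_prop) (by fun_prop),
    lintegral_withDensity_eq_lintegral_mul _ mP hΦ, lintegral_prod _ (by fun_prop)]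
  simp only [Pi.mul_apply]
  have e1 : ∀ q : R3 × R3, ∫⁻ r : R3 × R3, ENNReal.ofReal (invOnPos ρ q.2) * G (q.2, r.1) *
      ENNReal.ofReal (invOnPos ρ r.1) * Φ (q.1, r.2) ∂basicPlan ρ σ =
      ∫⁻ w, Φ (q.1, w) * (ENNReal.ofReal (invOnPos ρ q.2) *
        transferSnd (keepShare ρ σ) (refill ρ σ) (moveShare ρ σ) G (q.2, w)) := by
    intro q
    have h1 := lintegral_basicPlan_transfer hρ hσ hρ0 hσ0 (φ := fun w => Φ (q.1, w))
      (F := fun z => ENNReal.ofReal (invOnPos ρ q.2) * G (q.2, z)) (by fun_prop) (by fun_prop)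
    simp only [transfer_const_mul m5 (F := fun z => G (q.2, z)) (by fun_prop)] at h1
    refine Eq.trans (lintegral_congr fun r => ?_) h1
    ring
  simp only [← hGdef, e1]
  rw [lintegral_lintegral_swap (by fun_prop)]
  have e2 : ∀ w : R3, ∫⁻ q : R3 × R3, Φ (q.1, w) * (ENNReal.ofReal (invOnPos ρ q.2) *
        transferSnd (keepShare ρ σ) (refill ρ σ) (moveShare ρ σ) G (q.2, w)) ∂basicPlan σ ρ =
      ∫⁻ x, Φ (x, w) * combinedDensity ρ σ G (x, w) := fun w =>
    lintegral_basicPlan_swap_transfer hρ hσ hρ0 hσ0 hc (φ := fun x => Φ (x, w))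
      (F := fun y => transferSnd (keepShare ρ σ) (refill ρ σ) (moveShare ρ σ) G (y, w))
      (by fun_prop) (by fun_prop)
  simp only [e2]
  rw [lintegral_lintegral_swap (by fun_prop), lintegral_prod_eq (by fun_prop)]
  exact lintegral_congr fun x => lintegral_congr fun w => mul_comm _ _

end Plan

/-! ### Marginals and regularity of the combined density. -/

section Density

variable {ρ σ : R3 → ℝ}

theorem map_fst_withDensity {G : R3 × R3 → ℝ≥0∞} (hG : Measurable G) :
    (volume.withDensity G).map Prod.fst = volume.withDensity fun x => ∫⁻ z, G (x, z) := by
  refine Measure.ext_of_lintegral _ fun φ hφ => ?_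
  have hm : Measurable fun x : R3 => ∫⁻ z, G (x, z) := hG.lintegral_prod_right'
  rw [lintegral_map hφ measurable_fst,
    lintegral_withDensity_eq_lintegral_mul _ hG (by fun_prop),
    lintegral_withDensity_eq_lintegral_mul _ hm hφ, lintegral_prod_eq (by fun_prop)]
  exact lintegral_congr fun x => lintegral_mul_const (φ x) (f := fun z => G (x, z)) (by fun_prop)

theorem map_snd_withDensity {G : R3 × R3 → ℝ≥0∞} (hG : Measurable G) :
    (volume.withDensity G).map Prod.snd = volume.withDensity fun z => ∫⁻ x, G (x, z) := by
  refine Measure.ext_of_lintegral _ fun φ hφ => ?_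
  have hm : Measurable fun z : R3 => ∫⁻ x, G (x, z) := hG.lintegral_prod_left'
  rw [lintegral_map hφ measurable_snd,
    lintegral_withDensity_eq_lintegral_mul _ hG (by fun_prop),
    lintegral_withDensity_eq_lintegral_mul _ hm hφ, lintegral_prod_eq (by fun_prop),
    lintegral_lintegral_swap (by fun_prop)]
  exact lintegral_congr fun z => lintegral_mul_const (φ z) (f := fun x => G (x, z)) (by fun_prop)

/-- The first marginal of the combined density. -/
theorem lintegral_combinedDensity_snd (hρm : Measurable ρ) (hσm : Measurable σ)
    (hρ0 : ∀ x, 0 ≤ ρ x) (hσ0 : ∀ x, 0 ≤ σ x) (hρ : Integrable ρ) (hσ : Integrable σ)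
    (hmass : ∫ x, ρ x = ∫ x, σ x) {G : R3 × R3 → ℝ≥0∞} (hG : Measurable G)
    (hfst : ∀ᵐ x, ∫⁻ z, G (x, z) = ENNReal.ofReal (ρ x))
    (hsnd : ∀ᵐ z, ∫⁻ x, G (x, z) = ENNReal.ofReal (ρ z)) :
    ∀ᵐ x, ∫⁻ w, combinedDensity ρ σ G (x, w) = ENNReal.ofReal (σ x) := by
  have m4 := measurable_keepShare hρm hσm
  have m5 := measurable_moveShare hρm hσm
  have m6 := measurable_refill hρm hσm
  have hzero : ∀ᵐ z, ∀ᵐ y, ρ z = 0 → G (y, z) = 0 := by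
    filter_upwards [hsnd] with z hz
    by_cases h0 : ρ z = 0
    · rw [h0, ENNReal.ofReal_zero, lintegral_eq_zero_iff (by fun_prop)] at hz
      filter_upwards [hz] with y hy _ using hy
    · exact Eventually.of_forall fun y h => absurd h h0
  -- The transfer discards mass over the zeros of `ρ` in the second variable; the second marginal of
  -- `G` shows that there is none.
  have hzero' : ∀ᵐ y, ∀ᵐ z, ρ z = 0 → G (y, z) = 0 := by
    refine (Measure.ae_ae_comm ?_).1 hzero
    have : {p : R3 × R3 | ρ p.1 = 0 → G (p.2, p.1) = 0} =
        {p | ρ p.1 = 0}ᶜ ∪ {p | G (p.2, p.1) = 0} := by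
      ext p; simp [imp_iff_not_or]
    rw [this]
    exact (measurableSet_eq_fun (by fun_prop) (by fun_prop)).compl.union
      (measurableSet_eq_fun (by fun_prop) (by fun_prop))
  have hΓ : ∀ᵐ y, ∫⁻ w, transferSnd (keepShare ρ σ) (refill ρ σ) (moveShare ρ σ) G (y, w) =
      ENNReal.ofReal (ρ y) := by
    filter_upwards [hfst, hzero'] with y hy hz
    rw [← hy]
    refine (lintegral_transfer m4 m6 m5 (F := fun z => G (y, z)) (by fun_prop)).trans ?_
    refine lintegral_congr_ae ?_
    filter_upwards [hz, keepShare_add_eq hρ0 hσ0 hρ hσ hmass] with w h1 h2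
    rw [h2]
    by_cases h0 : ρ w = 0
    · rw [h1 h0, mul_zero]
    · rw [div_self h0, ENNReal.ofReal_one, one_mul]
  filter_upwards [transfer_congr_ae (h := keepShare ρ σ) (l := refill ρ σ)
    (k := moveShare ρ σ) hΓ, transfer_density hρ0 hσ0 hρ hσ hmass] with x h1 h2
  rw [combinedDensity, lintegral_transferFst_snd m5 (measurable_transferSnd m4 m6 m5 hG), h1, h2]

/-- The square root of the combined density has Lipschitz translates in the first variable. -/
theorem lipschitzTranslatesFst_combinedDensity (hρm : Measurable ρ) (hσm : Measurable σ)
    (hρ0 : ∀ x, 0 ≤ ρ x) (hσ0 : ∀ x, 0 ≤ σ x) (hρ : Integrable ρ) (hσ : Integrable σ)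
    (hmass : ∫ x, ρ x = ∫ x, σ x)
    (Lρ : LipschitzTranslates fun x => √(ρ x)) (Lσ : LipschitzTranslates fun x => √(σ x))
    {G : R3 × R3 → ℝ≥0∞} (hG : Measurable G)
    (hfst : ∀ᵐ x, ∫⁻ z, G (x, z) = ENNReal.ofReal (ρ x))
    (hsnd : ∀ᵐ z, ∫⁻ x, G (x, z) = ENNReal.ofReal (ρ z)) {β : ℝ} (hβ : 0 < β)
    (hpos : ∀ᵐ p : R3 × R3,
      ENNReal.ofReal β * (ENNReal.ofReal (ρ p.1) * ENNReal.ofReal (ρ p.2)) ≤ G p)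
    (LG : LipschitzTranslatesFst fun p => √(G p).toReal) :
    LipschitzTranslatesFst fun p => √(combinedDensity ρ σ G p).toReal := by
  have m4 := measurable_keepShare hρm hσm
  have m5 := measurable_moveShare hρm hσm
  have m6 := measurable_refill hρm hσm
  have hhk := keepShare_add_le hρ0 hσ0 hρ hσ hmass
  have hGfin : ∫⁻ p, G p ≠ ⊤ := by
    rw [lintegral_prod_eq hG, lintegral_congr_ae hfst]
    exact hρ.lintegral_lt_top.ne
  set Γ := transferSnd (keepShare ρ σ) (refill ρ σ) (moveShare ρ σ) G with hΓdef
  have mΓ : Measurable Γ := measurable_transferSnd m4 m6 m5 hG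
  have hΓfin : ∫⁻ p, Γ p ≠ ⊤ :=
    ((lintegral_transferSnd_le m4 m6 m5 hhk hG).trans_lt hGfin.lt_top).ne
  have hΓmarg : ∀ᵐ x, ∫⁻ w, Γ (x, w) ≤ ENNReal.ofReal (ρ x) := by
    filter_upwards [hfst] with x hx
    rw [← hx]
    refine (lintegral_transfer m4 m6 m5 (F := fun z => G (x, z)) (by fun_prop)).trans_le ?_
    refine lintegral_mono_ae ?_
    filter_upwards [hhk] with w hw
    exact mul_le_of_le_one_left' hw
  have mM : Measurable fun w => ∫⁻ y, moveShare ρ σ y * Γ (y, w) :=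
    Measurable.lintegral_prod_left' (f := fun q : R3 × R3 => moveShare ρ σ q.1 * Γ q)
      (by fun_prop)
  have hMle : ∀ w, ∫⁻ y, moveShare ρ σ y * Γ (y, w) ≤ ∫⁻ y, Γ (y, w) := fun w =>
    lintegral_mono fun y => mul_le_of_le_one_left' (moveShare_le_one hρ0 hσ0 y)
  have hMfin : ∫⁻ w, ∫⁻ y, moveShare ρ σ y * Γ (y, w) ≠ ⊤ := by
    refine ((lintegral_mono hMle).trans_lt ?_).ne
    rw [lintegral_lintegral_swap (by fun_prop), ← lintegral_prod_eq mΓ]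
    exact hΓfin.lt_top
  -- `M` is at most the second marginal of `Γ`, which is the transfer of `ρ`.
  have hMtr : ∀ᵐ w, ∫⁻ y, moveShare ρ σ y * Γ (y, w) ≤
      transfer (keepShare ρ σ) (refill ρ σ) (moveShare ρ σ)
        (fun z => ENNReal.ofReal (ρ z)) w := by
    filter_upwards [transfer_congr_ae (h := keepShare ρ σ) (l := refill ρ σ)
      (k := moveShare ρ σ) hsnd] with w hw
    rw [← hw, ← lintegral_transferSnd_fst m5 hG]
    exact hMle w
  -- Transferring `G ≥ β ρ ⊗ ρ` in the second variable gives `β ρ(x)` times the transfer of `ρ`,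
  -- which dominates `M`.
  have hΓpos : ∀ᵐ p : R3 × R3, ENNReal.ofReal β * ENNReal.ofReal (ρ p.1) *
      (∫⁻ y, moveShare ρ σ y * Γ (y, p.2)) ≤ Γ p := by
    refine ae_of_ae_ae (measurableSet_le (by fun_prop) mΓ) ?_
    rw [Measure.volume_eq_prod] at hpos
    filter_upwards [Measure.ae_ae_of_ae_prod hpos] with x hx
    filter_upwards [transfer_mono_ae (h := keepShare ρ σ) (l := refill ρ σ)
      (k := moveShare ρ σ) hx, hMtr] with w h1 h2
    simp only [← mul_assoc] at h1
    rw [transfer_const_mul m5 (by fun_prop)] at h1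
    refine le_trans ?_ h1
    gcongr
  exact lipschitzTranslatesFst_glued hρm hσm hρ0 hσ0 Lρ Lσ mΓ hΓfin hΓmarg mM hMfin hβ
    (inv_nonneg.2 (integral_nonneg (excess_nonneg σ ρ))) hΓpos
    (LG.transferSnd m4 m6 m5 hhk hG hGfin)

end Density

/-! ### Independence of the representatives of the densities. -/

section Congr

variable {ρ ρ' σ σ' : R3 → ℝ}

theorem densityMeasure_congr {F : Type*} [MeasureSpace F] {f g : F → ℝ}
    (h : f =ᵐ[volume] g) : densityMeasure f = densityMeasure g := by
  refine withDensity_congr_ae ?_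
  filter_upwards [h] with x hx
  rw [hx]

theorem excess_congr (hρ : ρ =ᵐ[volume] ρ') (hσ : σ =ᵐ[volume] σ') :
    excess ρ σ =ᵐ[volume] excess ρ' σ' := by
  filter_upwards [hρ, hσ] with x h1 h2
  simp only [excess, h1, h2]

theorem basicPlan_congr (hρ : ρ =ᵐ[volume] ρ') (hσ : σ =ᵐ[volume] σ') :
    basicPlan ρ σ = basicPlan ρ' σ' := by
  have h1 : densityMeasure (fun x => min (ρ x) (σ x)) =
      densityMeasure fun x => min (ρ' x) (σ' x) := by
    refine densityMeasure_congr ?_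
    filter_upwards [hρ, hσ] with x h1 h2
    rw [h1, h2]
  have h2 : densityMeasure (fun p : R3 × R3 =>
      excess ρ σ p.1 * excess σ ρ p.2 / ∫ y, excess σ ρ y) =
      densityMeasure fun p : R3 × R3 =>
        excess ρ' σ' p.1 * excess σ' ρ' p.2 / ∫ y, excess σ' ρ' y := by
    refine densityMeasure_congr ?_
    filter_upwards [ae_fst (excess_congr hρ hσ), ae_snd (excess_congr hσ hρ)] with p h1 h2
    rw [h1, h2, integral_congr_ae (excess_congr hσ hρ)]
  rw [basicPlan, basicPlan, h1, h2]

/-- The plan may be singular, but its marginals are absolutely continuous, so null sets of one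
variable remain null under it. -/
theorem quasiMeasurePreserving_fst_basicPlan (ρ σ : R3 → ℝ) :
    Measure.QuasiMeasurePreserving Prod.fst (basicPlan ρ σ) volume := by
  refine ⟨measurable_fst, ?_⟩
  rw [basicPlan, Measure.map_add _ _ measurable_fst,
    Measure.map_map measurable_fst (by fun_prop)]
  refine Measure.AbsolutelyContinuous.add_left ?_ ?_
  · exact (Measure.map_id (μ := densityMeasure _)).absolutelyContinuous.trans
      (withDensity_absolutelyContinuous _ _)
  · refine ((withDensity_absolutelyContinuous _ _).map measurable_fst).trans ?_
    rw [Measure.volume_eq_prod]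
    exact Measure.quasiMeasurePreserving_fst.2

theorem quasiMeasurePreserving_snd_basicPlan (ρ σ : R3 → ℝ) :
    Measure.QuasiMeasurePreserving Prod.snd (basicPlan ρ σ) volume := by
  refine ⟨measurable_snd, ?_⟩
  rw [basicPlan, Measure.map_add _ _ measurable_snd,
    Measure.map_map measurable_snd (by fun_prop)]
  refine Measure.AbsolutelyContinuous.add_left ?_ ?_
  · exact (Measure.map_id (μ := densityMeasure _)).absolutelyContinuous.trans
      (withDensity_absolutelyContinuous _ _)
  · refine ((withDensity_absolutelyContinuous _ _).map measurable_snd).trans ?_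
    rw [Measure.volume_eq_prod]
    exact Measure.quasiMeasurePreserving_snd.2

theorem combinedPlan_congr (hρ : ρ =ᵐ[volume] ρ') (hσ : σ =ᵐ[volume] σ')
    (γ : Measure (R3 × R3)) : combinedPlan ρ σ γ = combinedPlan ρ' σ' γ := by
  have h1 : ∀ᵐ q ∂(basicPlan σ' ρ').prod (basicPlan ρ' σ'), ρ q.1.2 = ρ' q.1.2 :=
    ((quasiMeasurePreserving_snd_basicPlan σ' ρ').comp
      Measure.quasiMeasurePreserving_fst).ae hρ
  have h2 : ∀ᵐ q ∂(basicPlan σ' ρ').prod (basicPlan ρ' σ'), ρ q.2.1 = ρ' q.2.1 :=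
    ((quasiMeasurePreserving_fst_basicPlan ρ' σ').comp
      Measure.quasiMeasurePreserving_snd).ae hρ
  rw [combinedPlan, combinedPlan, basicPlan_congr hσ hρ, basicPlan_congr hρ hσ]
  congr 1
  refine withDensity_congr_ae ?_
  filter_upwards [h1, h2] with q e1 e2
  simp only [invOnPos, e1, e2]

end Congr

/-! ### Measurable representatives and the conclusion. -/

theorem exists_measurable_rep {ρ : R3 → ℝ} (hρ0 : ∀ x, 0 ≤ ρ x)
    (h : AEStronglyMeasurable (fun x => √(ρ x)) volume) :
    ∃ ρ' : R3 → ℝ, Measurable ρ' ∧ (∀ x, 0 ≤ ρ' x) ∧ ρ =ᵐ[volume] ρ' := by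
  refine ⟨fun x => h.mk _ x ^ 2, h.stronglyMeasurable_mk.measurable.pow_const 2,
    fun x => sq_nonneg _, ?_⟩
  filter_upwards [h.ae_eq_mk] with x hx
  rw [← hx, Real.sq_sqrt (hρ0 x)]

/-- The main result for measurable densities and an explicit density of `γ`. -/
theorem combinedPlan_spec {ρ σ : R3 → ℝ} (hρm : Measurable ρ) (hσm : Measurable σ)
    (hρ0 : ∀ x, 0 ≤ ρ x) (hσ0 : ∀ x, 0 ≤ σ x) (hρ : Integrable ρ) (hσ : Integrable σ)
    (hmass : ∫ x, ρ x = ∫ x, σ x)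
    (Lρ : LipschitzTranslates fun x => √(ρ x)) (Lσ : LipschitzTranslates fun x => √(σ x))
    {γ : Measure (R3 × R3)}
    (hγ_marg : HasMarginals γ (densityMeasure ρ) (densityMeasure ρ))
    (hγ_sqrt : SqrtMemH1 γ) (hγ_pos : StronglyPositive γ) :
    HasMarginals (combinedPlan ρ σ γ) (densityMeasure σ) (densityMeasure σ) ∧
      SqrtMemH1 (combinedPlan ρ σ γ) := by
  obtain ⟨g, hg0, hγg, hgH⟩ := hγ_sqrt
  obtain ⟨β, hβ, hβγ⟩ := hγ_pos
  have hgm : AEMeasurable g volume := by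
    refine (hgH.1.1.aemeasurable.pow_const 2).congr (Eventually.of_forall fun x => ?_)
    exact Real.sq_sqrt (hg0 x)
  set G := γ.rnDeriv volume with hGdef
  have hG : Measurable G := Measure.measurable_rnDeriv γ volume
  have hGg : G =ᵐ[volume] fun p => ENNReal.ofReal (g p) := by
    rw [hGdef, hγg]
    exact Measure.rnDeriv_withDensity₀ volume hgm.ennreal_ofReal
  have hγG : γ = volume.withDensity G := by
    rw [hγg, densityMeasure]
    exact withDensity_congr_ae hGg.symm
  have hfst : ∀ᵐ x, ∫⁻ z, G (x, z) = ENNReal.ofReal (ρ x) := by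
    have h1 := hγ_marg.1
    rw [hγG, map_fst_withDensity hG, densityMeasure, withDensity_eq_iff_of_sigmaFinite
      hG.lintegral_prod_right'.aemeasurable (by fun_prop)] at h1
    exact h1
  have hsnd : ∀ᵐ z, ∫⁻ x, G (x, z) = ENNReal.ofReal (ρ z) := by
    have h1 := hγ_marg.2
    rw [hγG, map_snd_withDensity hG, densityMeasure, withDensity_eq_iff_of_sigmaFinite
      hG.lintegral_prod_left'.aemeasurable (by fun_prop)] at h1
    exact h1
  -- Strong positivity compares measures; comparing them on all measurable sets gives the inequality
  -- of densities almost everywhere.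
  have hpos : ∀ᵐ p : R3 × R3,
      ENNReal.ofReal β * (ENNReal.ofReal (ρ p.1) * ENNReal.ofReal (ρ p.2)) ≤ G p := by
    rw [hγ_marg.1, hγ_marg.2, densityMeasure, prod_withDensity (by fun_prop) (by fun_prop),
      ← withDensity_smul _ (by fun_prop), ← Measure.volume_eq_prod, hγG] at hβγ
    refine ae_le_of_forall_setLIntegral_le_of_sigmaFinite (by fun_prop) fun s hs _ => ?_
    have := hβγ s
    rwa [withDensity_apply _ hs, withDensity_apply _ hs] at this
  have LG : LipschitzTranslates fun p => √(G p).toReal := by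
    refine hgH.lipschitzTranslates.congr_ae ?_
    filter_upwards [hGg] with p hp
    rw [hp, ENNReal.toReal_ofReal (hg0 p)]
  have hc := integral_excess_comm hρ hσ hmass
  have hswap : Measurable fun p : R3 × R3 => G p.swap := by fun_prop
  have hpos' : ∀ᵐ p : R3 × R3,
      ENNReal.ofReal β * (ENNReal.ofReal (ρ p.1) * ENNReal.ofReal (ρ p.2)) ≤ G p.swap := by
    have hq : Measure.QuasiMeasurePreserving (Prod.swap : R3 × R3 → R3 × R3) volume volume :=
      (Measure.measurePreserving_swap (μ := (volume : Measure R3))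
        (ν := (volume : Measure R3))).quasiMeasurePreserving
    filter_upwards [hq.ae hpos] with p hp
    rwa [mul_comm (ENNReal.ofReal (ρ p.1))]
  have mP := measurable_combinedDensity hρm hσm hG
  have hP1 := lintegral_combinedDensity_snd hρm hσm hρ0 hσ0 hρ hσ hmass hG hfst hsnd
  have hP2 : ∀ᵐ w, ∫⁻ x, combinedDensity ρ σ G (x, w) = ENNReal.ofReal (σ w) := by
    filter_upwards [lintegral_combinedDensity_snd hρm hσm hρ0 hσ0 hρ hσ hmass hswap hsnd hfst]
      with w hw
    rw [← hw]
    exact lintegral_congr fun x => combinedDensity_swap hρm hσm hG (x, w)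
  have L1 := lipschitzTranslatesFst_combinedDensity hρm hσm hρ0 hσ0 hρ hσ hmass Lρ Lσ hG hfst
    hsnd hβ hpos LG.fst
  have L2 := lipschitzTranslatesFst_combinedDensity hρm hσm hρ0 hσ0 hρ hσ hmass Lρ Lσ hswap hsnd
    hfst hβ hpos' LG.swap.fst
  have hPfin : ∫⁻ p, combinedDensity ρ σ G p ≠ ⊤ := by
    rw [lintegral_prod_eq mP, lintegral_congr_ae hP1]
    exact hσ.lintegral_lt_top.ne
  rw [combinedPlan_eq_withDensity hρm hσm hρ0 hσ0 hc γ, ← hGdef]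
  refine ⟨⟨?_, ?_⟩, fun p => (combinedDensity ρ σ G p).toReal, fun p => ENNReal.toReal_nonneg,
    ?_, ?_⟩
  · rw [map_fst_withDensity mP]
    exact withDensity_congr_ae hP1
  · rw [map_snd_withDensity mP]
    exact withDensity_congr_ae hP2
  · refine withDensity_congr_ae ?_
    filter_upwards [ae_lt_top mP hPfin] with p hp
    rw [ENNReal.ofReal_toReal hp.ne]
  · refine memH1_of_lipschitzTranslates (memLp_sqrt_toReal mP.aemeasurable hPfin)
      (lipschitzTranslates_of_fst_of_swap (by fun_prop) L1 ?_)
    have he : (fun p : R3 × R3 => √(combinedDensity ρ σ G p.swap).toReal) =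
        fun p => √(combinedDensity ρ σ (fun q => G q.swap) p).toReal :=
      funext fun p => by rw [combinedDensity_swap hρm hσm hG, Prod.swap_swap]
    rw [he]
    exact L2

end GluedPlan

theorem theorem5p5 (ρA ρB : R3 → ℝ)
    (hA_nonneg : ∀ x, 0 ≤ ρA x) (hB_nonneg : ∀ x, 0 ≤ ρB x)
    (hA_mass : ∫ x, ρA x = 1) (hB_mass : ∫ x, ρB x = 1)
    (hA_sqrt : MemH1 fun x => √(ρA x)) (hB_sqrt : MemH1 fun x => √(ρB x))
    (γ : Measure (R3 × R3))
    (hγ_marg : HasMarginals γ (densityMeasure ρA) (densityMeasure ρA))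
    (hγ_sqrt : SqrtMemH1 γ) (hγ_pos : StronglyPositive γ) :
    HasMarginals (combinedPlan ρA ρB γ) (densityMeasure ρB) (densityMeasure ρB) ∧
      SqrtMemH1 (combinedPlan ρA ρB γ) := by
  obtain ⟨ρ, hρm, hρ0, hρ⟩ := exists_measurable_rep hA_nonneg hA_sqrt.1.1
  obtain ⟨σ, hσm, hσ0, hσ⟩ := exists_measurable_rep hB_nonneg hB_sqrt.1.1
  -- The integral of a non-integrable function is `0` by convention, so mass 1 yields integrability.
  have iA : Integrable ρA := .of_integral_ne_zero (by rw [hA_mass]; exact one_ne_zero)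
  have iB : Integrable ρB := .of_integral_ne_zero (by rw [hB_mass]; exact one_ne_zero)
  have hmass : ∫ x, ρ x = ∫ x, σ x := by
    rw [← integral_congr_ae hρ, ← integral_congr_ae hσ, hA_mass, hB_mass]
  rw [combinedPlan_congr hρ hσ, densityMeasure_congr hσ]
  rw [densityMeasure_congr hρ] at hγ_marg
  refine combinedPlan_spec hρm hσm hρ0 hσ0 (iA.congr hρ) (iB.congr hσ) hmass ?_ ?_ hγ_marg
    hγ_sqrt hγ_pos
  · exact hA_sqrt.lipschitzTranslates.congr_ae (hρ.mono fun x hx => by simp only [hx])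
  · exact hB_sqrt.lipschitzTranslates.congr_ae (hσ.mono fun x hx => by simp only [hx])
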